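/- For a nonnegative integer or half-integer $L$ let $\mathcal H_L=\mathbb C^{2L+1}$ be the spin-$L$ representation space of $SU(2)$, with spin operators $\mathbf S_L=(S_x,S_y,S_z)$. For $\omega$ in the unit sphere $\mathbb S^2\subset\mathbb R^3$ let $|\omega\rangle\langle\omega|$ be the coherent state projection on $\mathcal H_L$, i.e. the orthogonal projection onto the (one-dimensional) eigenspace of $\omega\cdot\mathbf S_L$ with eigenvalue $L$. Let $J,K$ be nonnegative integers or half-integers, let $k=2(K-J)\in\mathbb Z$, and let $P_-$ be the orthogonal projection in $\mathcal H_J\otimes\mathcal H_K$ onto the subspace of minimal total spin $|K-J|$, i.e. onto the eigenspace, with eigenvalue $|K-J|(|K-J|+1)$, of the square of the total spin operator $\mathbf S_J\otimes I_K+I_J\otimes\mathbf S_K$. Define, for operators $\rho$ on $\mathcal H_J$, $$\Phi^k(\rho)=\frac{2J+1}{2|K-J|+1}\,\mathrm{Tr}_J\bigl(P_-(\rho\otimes I_K)\bigr),$$ an operator on $\mathcal H_K$, where $\mathrm{Tr}_J$ is the partial trace over $\mathcal H_J$. **Theorem.** The map $\Phi^k$ maps density matrices (positive semidefinite matrices of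 trace one) on $\mathcal H_J$ to density matrices on $\mathcal H_K$. The eigenvalue sequence of $\Phi^k(|\omega\rangle\langle\omega|)$, in decreasing order and with multiplicity, is independent of $\omega\in\mathbb S^2$. For every density matrix $\rho$ on $\mathcal H_J$ and every $\omega\in\mathbb S^2$, the eigenvalue sequence of $\Phi^k(\rho)$ is majorized by that of $\Phi^k(|\omega\rangle\langle\omega|)$: if $a_1\ge\dots\ge a_{2K+1}$ are the eigenvalues of $\Phi^k(|\omega\rangle\langle\omega|)$ and $b_1\ge\dots\ge b_{2K+1}$ those of $\Phi^k(\rho)$, then $$\sum_{i=1}^{r}a_i\ge\sum_{i=1}^{r}b_i\quad(1\le r\le 2K),\qquad \sum_{i=1}^{2K+1}a_i=\sum_{i=1}^{2K+1}b_i .$$ -/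

import Mathlib

open scoped Kronecker ComplexOrder

noncomputable section

namespace BlochCoherent

/-- Spin `J = n / 2` Hilbert space `ℂ^(2J+1)`: the basis index `i : Fin (n + 1)` stands for the
vector `|M⟩` with `M = J - i`. Operators on it are matrices in this orthonormal basis. -/
abbrev SpinOp (n : ℕ) : Type := Matrix (Fin (n + 1)) (Fin (n + 1)) ℂ

/-- The raising operator `S₊ = S_x + i S_y` of spin `J = n / 2`:
`S₊ |M⟩ = √((J - M) (J + M + 1)) |M + 1⟩`; with `M = J - j` the coefficient is
`√(j (n + 1 - j))`. -/
def spinRaise (n : ℕ) : SpinOp n :=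
  Matrix.of fun i j =>
    if (i : ℕ) + 1 = (j : ℕ) then ((Real.sqrt ((j : ℝ) * ((n : ℝ) + 1 - (j : ℝ))) : ℝ) : ℂ) else 0

/-- `S_x = (S₊ + S₊*) / 2`. -/
def spinX (n : ℕ) : SpinOp n := (1 / 2 : ℂ) • (spinRaise n + (spinRaise n).conjTranspose)

/-- `S_y = (S₊ - S₊*) / (2 i)`. -/
def spinY (n : ℕ) : SpinOp n :=
  (1 / (2 * Complex.I) : ℂ) • (spinRaise n - (spinRaise n).conjTranspose)

/-- `S_z`, diagonal with entries `M = J, J - 1, …, -J`. -/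
def spinZ (n : ℕ) : SpinOp n := Matrix.diagonal fun i => (n : ℂ) / 2 - ((i : ℕ) : ℂ)

/-- The vector of spin operators `(S_x, S_y, S_z)` of spin `n / 2`. -/
def spinVec (n : ℕ) : Fin 3 → SpinOp n := ![spinX n, spinY n, spinZ n]

/-- The orthogonal projection (as a matrix) onto the eigenspace `{v | A v = c v}`, with respect to
the standard Hermitian inner product. -/
def eigenProj {ι : Type*} [Fintype ι] [DecidableEq ι] (A : Matrix ι ι ℂ) (c : ℂ) :
    Matrix ι ι ℂ :=
  (Matrix.toEuclideanCLM (n := ι) (𝕜 := ℂ)).symm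
    (Module.End.eigenspace (Matrix.toEuclideanLin A) c).starProjection

/-- The unit sphere in `ℝ³`. -/
abbrev Sphere2 : Type := Metric.sphere (0 : EuclideanSpace ℝ (Fin 3)) 1

/-- The coherent state projection `|ω⟩⟨ω|` of spin `J = n / 2`: the projection onto the subspace of
maximal spin in direction `ω`, i.e. onto the eigenspace of `ω · S` with eigenvalue `J`. -/
def coherentProj (n : ℕ) (ω : Sphere2) : SpinOp n :=
  eigenProj (∑ a : Fin 3, ((ω.1 a : ℝ) : ℂ) • spinVec n a) ((n : ℂ) / 2)

/-- Total spin operators `S_J ⊗ I + I ⊗ S_K` on `H_J ⊗ H_K`, with `n = 2J` and `m = 2K`. -/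
def totalSpin (n m : ℕ) (a : Fin 3) :
    Matrix (Fin (n + 1) × Fin (m + 1)) (Fin (n + 1) × Fin (m + 1)) ℂ :=
  spinVec n a ⊗ₖ (1 : SpinOp m) + (1 : SpinOp n) ⊗ₖ spinVec m a

/-- The square of the total spin on `H_J ⊗ H_K`. -/
def totalSpinSq (n m : ℕ) :
    Matrix (Fin (n + 1) × Fin (m + 1)) (Fin (n + 1) × Fin (m + 1)) ℂ :=
  ∑ a : Fin 3, totalSpin n m a * totalSpin n m a

/-- The minimal total spin `|K - J|`, with `n = 2J` and `m = 2K`. -/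
def minSpin (n m : ℕ) : ℝ := |(m : ℝ) / 2 - (n : ℝ) / 2|

/-- `P_-`: the projection onto the vectors of total spin `s = |K - J|` in `H_J ⊗ H_K`, that is,
onto the eigenspace of the square of the total spin with eigenvalue `s (s + 1)`. -/
def minSpinProj (n m : ℕ) :
    Matrix (Fin (n + 1) × Fin (m + 1)) (Fin (n + 1) × Fin (m + 1)) ℂ :=
  eigenProj (totalSpinSq n m) ((minSpin n m * (minSpin n m + 1) : ℝ) : ℂ)

/-- Partial trace over the first tensor factor. -/
def partialTraceLeft {ι κ : Type*} [Fintype ι] (A : Matrix (ι × κ) (ι × κ) ℂ) : Matrix κ κ ℂ :=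
  Matrix.of fun a b => ∑ i : ι, A (i, a) (i, b)

/-- The channel `Φ^k`, `k = 2 (K - J)`, from operators on `H_J` to operators on `H_K`, with `n = 2J`
and `m = 2K`: `Φ^k(ρ) = (2J + 1) / (2 |K - J| + 1) Tr_J (P_- (ρ ⊗ I_K))`. -/
def channel (n m : ℕ) (ρ : SpinOp n) : SpinOp m :=
  ((((n : ℝ) + 1) / (2 * minSpin n m + 1) : ℝ) : ℂ) •
    partialTraceLeft (minSpinProj n m * (ρ ⊗ₖ (1 : SpinOp m)))

/-- Density matrices: positive semidefinite of trace one. -/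
def IsDensityMatrix {ι : Type*} [Fintype ι] (ρ : Matrix ι ι ℂ) : Prop :=
  ρ.PosSemidef ∧ ρ.trace = 1

/-- The decreasing sequence `a` majorizes the decreasing sequence `b`: each partial sum of `a` is at
least that of `b`, and the full sums agree. -/
def SeqMajorizes {M : ℕ} (a b : Fin M → ℝ) : Prop :=
  Antitone a ∧ Antitone b ∧
    (∀ r : ℕ, r < M →
      ∑ i : Fin M with i.val < r, b i ≤ ∑ i : Fin M with i.val < r, a i) ∧
    ∑ i, a i = ∑ i, b i

/-- `A ≻ B`: both matrices are Hermitian and the eigenvalue sequence of `A` (decreasing, with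
multiplicity) majorizes that of `B`. -/
def Majorizes {ι : Type*} [Fintype ι] [DecidableEq ι] (A B : Matrix ι ι ℂ) : Prop :=
  ∃ (hA : A.IsHermitian) (hB : B.IsHermitian), SeqMajorizes hA.eigenvalues₀ hB.eigenvalues₀

/-- Both matrices are Hermitian, with the same eigenvalue sequence (decreasing, with
multiplicity). -/
def SameEigenvalues {ι : Type*} [Fintype ι] [DecidableEq ι] (A B : Matrix ι ι ℂ) : Prop :=
  ∃ (hA : A.IsHermitian) (hB : B.IsHermitian), hA.eigenvalues₀ = hB.eigenvalues₀

end BlochCoherent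

end

open scoped Kronecker ComplexOrder

noncomputable section

namespace BlochCoherent

open Matrix

/-! ### Ky Fan's variational bounds on partial eigenvalue sums -/

section KyFan

variable {ι κ : Type*} [Fintype ι] [Fintype κ]

/-! Realize spin `n / 2` as the homogeneous polynomials of degree `n` in `x, y` with the Bargmann
inner product, in which `x^(n-i) y^i` has norm `√(i! (n-i)!)`. Multiplication of polynomials then
intertwines the rotations, and `fusionCoeff` lists its matrix elements in the normalized monomials
`e_i`.

Upward case, `m = n + k`. The range of `P_-` is spanned by the vectors `∑ (-1)^i e_i ⊗ (e_(n-i)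
e_q)`. So, up to a constant and a time reversal of the input, the channel is `ρ ↦ W (ρ ⊗ I) W*` with
`W` the multiplication map (`channel_add`). By convexity it is enough to bound partial eigenvalue
sums for a rank-one `ρ = ψψ*`. The output is then `M M*`, where `M` multiplies by `ψ` from degree
`k` to degree `n + k`, and it obeys the same Ky Fan bounds as `M* M`, which acts in degree `k`
(`KyFanLE.gram`). Normal ordering expands `M* M` as a sum over `l ≤ min n k` of cloning maps from
degree `l` to degree `k`, applied to the `l`-particle reduced matrices of `ψ`
(`conjTranspose_fusionMat_mul_fusionMat`). Their traces are `C(n,l) ‖ψ‖²`, whatever the direction of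
`ψ`. Induction on the output degree bounds each term, and Ky Fan bounds add (`kyFanLE_cloning`).
Nothing is lost at a coherent state: the bounds add up exactly to the partial sums of its spectrum,
which is the binomial identity `sum_choose_recursion`. The recursion ends at `n = 0`, where the
output is a multiple of the identity.

Downward case, `n = m + k`. The channel is a partial trace followed by time reversal
(`channel_add_left`). It sends a coherent state to a rank-one projection, which majorizes every
density matrix.

Rotations implemented on both spins commute with the channel (`channel_conj`), so the output
spectrum does not depend on `ω`. The comparison is made at the south pole, since time reversal turns
`y^n` into `x^n`, whose cloned state is diagonal with decreasing entries. -/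

theorem trace_conjTranspose_mul_self_re_nonneg (A : Matrix κ ι ℂ) : 0 ≤ (Aᴴ * A).trace.re :=
  (Complex.nonneg_iff.mp (posSemidef_conjTranspose_mul_self A).trace_nonneg).1

theorem trace_re_nonneg_of_isProj {X : Matrix ι ι ℂ} (h : X.IsHermitian) (h2 : X * X = X) :
    0 ≤ X.trace.re := by
  have := trace_conjTranspose_mul_self_re_nonneg X
  rwa [h.eq, h2] at this

/-- `∑_{i < r} λ_i(A) ≤ x` in variational form (Ky Fan): the trace of `A` against each orthogonal
projection of rank at most `r` is at most `x`. -/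
def KyFanLE (A : Matrix ι ι ℂ) (r : ℕ) (x : ℝ) : Prop :=
  ∀ X : Matrix ι ι ℂ, X.IsHermitian → X * X = X → X.trace.re ≤ r → (X * A).trace.re ≤ x

theorem KyFanLE.add {A B : Matrix ι ι ℂ} {r : ℕ} {x y : ℝ} (hA : KyFanLE A r x)
    (hB : KyFanLE B r y) : KyFanLE (A + B) r (x + y) := by
  intro X h1 h2 h3
  rw [Matrix.mul_add, trace_add, Complex.add_re]
  exact add_le_add (hA X h1 h2 h3) (hB X h1 h2 h3)

theorem kyFanLE_zero (r : ℕ) : KyFanLE (0 : Matrix ι ι ℂ) r 0 := by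
  intro X _ _ _
  simp

theorem KyFanLE.sum {α : Type*} (s : Finset α) {A : α → Matrix ι ι ℂ} {r : ℕ} {x : α → ℝ}
    (h : ∀ a ∈ s, KyFanLE (A a) r (x a)) : KyFanLE (∑ a ∈ s, A a) r (∑ a ∈ s, x a) := by
  classical
  induction s using Finset.induction_on with
  | empty => simpa using kyFanLE_zero r
  | insert a s ha ih =>
    rw [Finset.sum_insert ha, Finset.sum_insert ha]
    exact (h a (Finset.mem_insert_self a s)).add
      (ih fun b hb => h b (Finset.mem_insert_of_mem hb))

theorem KyFanLE.smul {A : Matrix ι ι ℂ} {r : ℕ} {x c : ℝ} (hc : 0 ≤ c) (h : KyFanLE A r x) :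
    KyFanLE ((c : ℂ) • A) r (c * x) := by
  intro X h1 h2 h3
  rw [Matrix.mul_smul, trace_smul, smul_eq_mul, Complex.re_ofReal_mul]
  exact mul_le_mul_of_nonneg_left (h X h1 h2 h3) hc

theorem trace_re_le_card_of_isProj [DecidableEq ι] {X : Matrix ι ι ℂ} (h : X.IsHermitian)
    (h2 : X * X = X) : X.trace.re ≤ Fintype.card ι := by
  have h3 : 0 ≤ (1 - X).trace.re := by
    refine trace_re_nonneg_of_isProj (isHermitian_one.sub h) ?_
    simp [Matrix.mul_sub, Matrix.sub_mul, h2]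
  simp [trace_sub] at h3
  linarith

/-- A Hermitian matrix has a Hermitian commuting pseudo-inverse. -/
theorem exists_pseudoinverse [DecidableEq κ] {A : Matrix κ κ ℂ} (hA : A.IsHermitian) :
    ∃ Y : Matrix κ κ ℂ, Y.IsHermitian ∧ Y * A = A * Y ∧ Y * A * A = A ∧ Y * A * Y = Y := by
  obtain ⟨U, l, hUU, hspec⟩ : ∃ (U : Matrix κ κ ℂ) (l : κ → ℝ), Uᴴ * U = 1 ∧
      A = U * diagonal (fun i => (l i : ℂ)) * Uᴴ :=
    ⟨_, _, Unitary.coe_star_mul_self hA.eigenvectorUnitary, hA.spectral_theorem⟩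
  have key : ∀ d e : κ → ℂ, (U * diagonal d * Uᴴ) * (U * diagonal e * Uᴴ) =
      U * diagonal (d * e) * Uᴴ := by
    intro d e
    calc _ = U * diagonal d * (Uᴴ * U) * diagonal e * Uᴴ := by simp only [Matrix.mul_assoc]
      _ = U * (diagonal d * diagonal e) * Uᴴ := by
        rw [hUU, Matrix.mul_one, Matrix.mul_assoc U]
      _ = _ := by rw [diagonal_mul_diagonal]; rfl
  subst hspec
  refine ⟨U * diagonal (fun i => ((l i : ℂ))⁻¹) * Uᴴ, ?_, ?_, ?_, ?_⟩
  · refine isHermitian_mul_mul_conjTranspose _ ?_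
    refine isHermitian_diagonal_iff.mpr fun i => ?_
    simp [IsSelfAdjoint, ← Complex.ofReal_inv]
  · rw [key, key, mul_comm]
  · rw [key, key]
    congr 3
    ext i
    by_cases h : (l i : ℂ) = 0 <;> simp [h]
  · rw [key, key]
    congr 3
    ext i
    by_cases h : (l i : ℂ) = 0 <;> simp [h]

/-- `M Mᴴ` obeys the same Ky Fan bounds as `Mᴴ M`. -/
theorem KyFanLE.gram [DecidableEq κ] {M : Matrix κ ι ℂ} {r : ℕ} {x : ℝ}
    (h : KyFanLE (Mᴴ * M) r x) : KyFanLE (M * Mᴴ) r x := by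
  intro X hX hXX hr
  -- With `N = X M`, the trace to be bounded is that of `N Nᴴ`. The pseudo-inverse `Y` of `N Nᴴ`
  -- makes `Y * A` the projection onto the range of `N`, a subprojection of `X`.
  set N := X * M with hN
  have hXN : X * N = N := by rw [hN, ← Matrix.mul_assoc, hXX]
  have hNh : Nᴴ = Mᴴ * X := by rw [hN, conjTranspose_mul, hX.eq]
  obtain ⟨Y, hY, hc, hYAA, hYAY⟩ := exists_pseudoinverse (isHermitian_mul_conjTranspose_self N)
  set A := N * Nᴴ with hA
  have hAh : A.IsHermitian := isHermitian_mul_conjTranspose_self N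
  have hXA : X * A = A := by rw [hA, ← Matrix.mul_assoc, hXN]
  have hZh : (Y * A).IsHermitian := by
    rw [IsHermitian, conjTranspose_mul, hY.eq, hAh.eq, hc]
  have hZZ : (Y * A) * (Y * A) = Y * A := by rw [← Matrix.mul_assoc, hYAY]
  have hXZ : X * (Y * A) = Y * A := by rw [hc, ← Matrix.mul_assoc, hXA]
  have hZX : (Y * A) * X = Y * A := by
    have := congrArg conjTranspose hXZ
    rwa [conjTranspose_mul, hZh.eq, hX.eq] at this
  have htr : (Y * A).trace.re ≤ X.trace.re := by
    have : 0 ≤ (X - Y * A).trace.re := by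
      refine trace_re_nonneg_of_isProj (hX.sub hZh) ?_
      rw [Matrix.mul_sub, Matrix.sub_mul, Matrix.sub_mul, hXX, hZX, hXZ, hZZ]
      simp
    rw [trace_sub, Complex.sub_re] at this
    linarith
  -- The projection onto the range of `Nᴴ`. It has the rank of `N`, hence at most that of `X`, so
  -- the hypothesis applies to it.
  set X' := Nᴴ * Y * N with hX'
  have hX'h : X'.IsHermitian := isHermitian_conjTranspose_mul_mul _ hY
  have hX'X' : X' * X' = X' := by
    calc X' * X' = Nᴴ * (Y * (N * Nᴴ) * Y) * N := by simp only [hX', Matrix.mul_assoc]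
      _ = X' := by rw [← hA, hYAY]
  have htr' : X'.trace = (Y * A).trace := by
    rw [hX', trace_mul_comm, ← Matrix.mul_assoc, ← hA, hc]
  have h1 := h X' hX'h hX'X' (by rw [htr']; linarith)
  have h2 : (X' * (Nᴴ * N)).trace = (X * (M * Mᴴ)).trace := by
    calc (X' * (Nᴴ * N)).trace = ((Nᴴ * (Y * (N * Nᴴ))) * N).trace := by
          simp only [hX', Matrix.mul_assoc]
      _ = (Y * A * A).trace := by
          rw [trace_mul_comm, ← Matrix.mul_assoc, ← hA, trace_mul_comm]
      _ = (X * M * (Mᴴ * X)).trace := by rw [hYAA, hA, hNh]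
      _ = (X * (X * M * Mᴴ)).trace := by
          rw [trace_mul_comm X, Matrix.mul_assoc (X * M)]
      _ = _ := by rw [← Matrix.mul_assoc, ← Matrix.mul_assoc, hXX, Matrix.mul_assoc]
  -- The difference is the squared Hilbert-Schmidt norm of `(1 - X) M X'`.
  have h3 : 0 ≤ (X' * (Mᴴ * M)).trace.re - (X' * (Nᴴ * N)).trace.re := by
    have h4 := trace_conjTranspose_mul_self_re_nonneg ((1 - X) * M * X')
    have h5 : ((1 - X) * M * X')ᴴ * ((1 - X) * M * X') =
        X' * (Mᴴ * M - Nᴴ * N) * X' := by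
      have : Mᴴ * M - Nᴴ * N = Mᴴ * ((1 - X) * (1 - X)) * M := by
        have : (1 - X) * (1 - X) = 1 - X := by simp [Matrix.mul_sub, Matrix.sub_mul, hXX]
        rw [this, hNh, hN, Matrix.mul_sub, Matrix.sub_mul, Matrix.mul_one, Matrix.mul_assoc Mᴴ X,
          ← Matrix.mul_assoc X X, hXX, Matrix.mul_assoc]
      rw [this, conjTranspose_mul ((1 - X) * M) X', conjTranspose_mul (1 - X) M, hX'h.eq, (isHermitian_one.sub hX).eq]
      simp only [Matrix.mul_assoc]
    rw [h5, trace_mul_comm, ← Matrix.mul_assoc, hX'X', Matrix.mul_sub, trace_sub,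
      Complex.sub_re] at h4
    exact h4
  rw [← h2]
  linarith

end KyFan

/-! ### From Ky Fan bounds to ordered eigenvalue sequences -/

section Eigenvalues

variable {ι : Type*} [Fintype ι] [DecidableEq ι]

theorem eigenvalues₀_eq_of_charpoly_eq {A B : Matrix ι ι ℂ} (hA : A.IsHermitian)
    (hB : B.IsHermitian) (h : A.charpoly = B.charpoly) : hA.eigenvalues₀ = hB.eigenvalues₀ := by
  rw [← List.ofFn_inj, ← IsHermitian.sort_roots_charpoly_eq_eigenvalues₀,
    ← IsHermitian.sort_roots_charpoly_eq_eigenvalues₀, h]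

theorem sum_eigenvalues₀ {A : Matrix ι ι ℂ} (hA : A.IsHermitian) :
    ∑ i, hA.eigenvalues₀ i = A.trace.re := by
  rw [hA.trace_eq_sum_eigenvalues]
  have : ∑ i, hA.eigenvalues i = ∑ i, hA.eigenvalues₀ i :=
    Equiv.sum_comp (Fintype.equivOfCardEq (Fintype.card_fin _)).symm hA.eigenvalues₀
  rw [← this]
  simp

/-- An antitone diagonal is already the sorted list of characteristic roots. The cast appears
because `eigenvalues₀` is indexed by `Fin (Fintype.card (Fin N))`. -/
theorem eigenvalues₀_diagonal {N : ℕ} {d : Fin N → ℝ} (hd : Antitone d)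
    (hA : (diagonal fun i => (d i : ℂ)).IsHermitian) :
    hA.eigenvalues₀ = d ∘ Fin.cast (Fintype.card_fin N) := by
  have h1 : (diagonal fun i => (d i : ℂ)).charpoly.roots =
      Multiset.map (fun i => (d i : ℂ)) Finset.univ.val := by
    rw [charpoly_diagonal, Polynomial.roots_prod]
    · simp
    · simp [Finset.prod_ne_zero_iff, Polynomial.X_sub_C_ne_zero]
  have h2 := hA.sort_roots_charpoly_eq_eigenvalues₀
  rw [h1] at h2
  have h3 : (Multiset.map RCLike.re (Multiset.map (fun i => (d i : ℂ)) Finset.univ.val)).sort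
      (· ≥ ·) = List.ofFn d := by
    simp_rw [Fin.univ_val_map, Multiset.map_coe, List.map_ofFn, Multiset.coe_sort]
    apply List.mergeSort_of_pairwise
    simp_rw [decide_eq_true_eq, ← List.sortedGE_iff_pairwise]
    exact hd.sortedGE_ofFn
  rw [h3] at h2
  rw [← List.ofFn_inj, ← h2]
  exact List.ofFn_congr (Fintype.card_fin N).symm d

/-- A Ky Fan bound controls the sum of the `r` largest eigenvalues. -/
theorem KyFanLE.sum_eigenvalues₀_le {A : Matrix ι ι ℂ} (hA : A.IsHermitian) {r : ℕ} {x : ℝ}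
    (h : KyFanLE A r x) :
    ∑ i : Fin (Fintype.card ι) with i.val < r, hA.eigenvalues₀ i ≤ x := by
  set U : Matrix ι ι ℂ := hA.eigenvectorUnitary.val with hU
  have hUU : Uᴴ * U = 1 := Unitary.coe_star_mul_self hA.eigenvectorUnitary
  set e := (Fintype.equivOfCardEq (Fintype.card_fin (Fintype.card ι))).symm with he
  set p : ι → ℂ := fun i => if (e i).val < r then 1 else 0 with hp
  have hspec : A = U * diagonal (fun i => (hA.eigenvalues i : ℂ)) * Uᴴ := hA.spectral_theorem
  have key : ∀ d d' : ι → ℂ, (U * diagonal d * Uᴴ) * (U * diagonal d' * Uᴴ) =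
      U * diagonal (d * d') * Uᴴ := by
    intro d d'
    calc _ = U * diagonal d * (Uᴴ * U) * diagonal d' * Uᴴ := by simp only [Matrix.mul_assoc]
      _ = U * (diagonal d * diagonal d') * Uᴴ := by
        rw [hUU, Matrix.mul_one, Matrix.mul_assoc U]
      _ = _ := by rw [diagonal_mul_diagonal]; rfl
  have htr : ∀ d : ι → ℂ, (U * diagonal d * Uᴴ).trace = ∑ i, d i := by
    intro d
    rw [trace_mul_comm, ← Matrix.mul_assoc, hUU, Matrix.one_mul, trace_diagonal]
  -- Test against the spectral projection onto the first `r` eigenvectors.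
  have h1 := h (U * diagonal p * Uᴴ) ?_ ?_ ?_
  · rw [hspec, key, htr] at h1
    refine le_trans (le_of_eq ?_) h1
    rw [Complex.re_sum, ← Equiv.sum_comp e.symm, Finset.sum_filter]
    refine Finset.sum_congr rfl fun i _ => ?_
    have : hA.eigenvalues (e.symm i) = hA.eigenvalues₀ i := by
      simp [IsHermitian.eigenvalues, he]
    simp only [Pi.mul_apply, hp, Equiv.apply_symm_apply, this]
    split_ifs <;> simp
  · refine isHermitian_mul_mul_conjTranspose _ ?_
    refine isHermitian_diagonal_iff.mpr fun i => ?_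
    simp only [hp, IsSelfAdjoint]
    split_ifs <;> simp
  · rw [key]
    congr 3
    ext i
    simp [hp]
  · rw [htr, Complex.re_sum, ← Equiv.sum_comp e.symm]
    have : ∀ i : Fin (Fintype.card ι), (p (e.symm i)).re = if i.val < r then 1 else 0 := by
      intro i
      simp only [hp, Equiv.apply_symm_apply]
      split_ifs <;> simp
    simp only [this]
    rw [Finset.sum_boole]
    have h2 : (Finset.univ.filter fun i : Fin (Fintype.card ι) => i.val < r).card ≤
        (Finset.range r).card :=
      Finset.card_le_card_of_injOn (fun i => i.val) (fun i hi => by simpa using hi)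
        (fun i _ j _ hij => Fin.ext hij)
    rw [Finset.card_range] at h2
    exact_mod_cast h2

/-- If `A` has the eigenvalues of an antitone diagonal matrix, Ky Fan bounds with the partial sums
of that diagonal give majorization. -/
theorem majorizes_of_kyFanLE {N : ℕ} {A B : Matrix (Fin N) (Fin N) ℂ} {d : Fin N → ℝ}
    (hd : Antitone d) (hA : SameEigenvalues A (diagonal fun i => (d i : ℂ))) (hB : B.IsHermitian)
    (hKF : ∀ r : ℕ, KyFanLE B r (∑ i : Fin N with i.val < r, d i))
    (htr : B.trace.re = ∑ i, d i) : Majorizes A B := by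
  obtain ⟨hA1, hA2, hA3⟩ := hA
  refine ⟨hA1, hB, IsHermitian.eigenvalues₀_antitone _, IsHermitian.eigenvalues₀_antitone _, ?_, ?_⟩
  · intro r _
    refine ((hKF r).sum_eigenvalues₀_le hB).trans (le_of_eq ?_)
    rw [hA3, eigenvalues₀_diagonal hd, Finset.sum_filter, Finset.sum_filter]
    exact ((finCongr (Fintype.card_fin N)).sum_comp fun i => if i.val < r then d i else 0).symm
  · rw [hA3, sum_eigenvalues₀ hB, htr, eigenvalues₀_diagonal hd]
    exact (finCongr (Fintype.card_fin N)).sum_comp d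

end Eigenvalues

open Finset
open scoped Nat

/-! ### Binomial identities and matrix elements of polynomial multiplication -/

section Combinatorics

/-- Sort the `(a + b + 1)`-subsets of `{0, …, m}` by their element `s` that has exactly `a` elements
below it. -/
theorem sum_choose_mul_choose_sub (m a b : ℕ) :
    ∑ s ∈ range (m + 1), s.choose a * (m - s).choose b = (m + 1).choose (a + b + 1) := by
  induction m generalizing b with
  | zero =>
    cases a <;> cases b <;> simp [Nat.choose_eq_zero_of_lt]
  | succ m ih =>
    cases b with
    | zero =>
      have h := ih 0
      simp only [Nat.choose_zero_right, mul_one, add_zero] at h ⊢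
      rw [sum_range_succ, h, Nat.choose_succ_succ (m + 1), add_comm]
    | succ b =>
      rw [sum_range_succ]
      have : ∀ s ∈ range (m + 1), s.choose a * (m + 1 - s).choose (b + 1) =
          s.choose a * (m - s).choose b + s.choose a * (m - s).choose (b + 1) := by
        intro s hs
        rw [show m + 1 - s = (m - s) + 1 by have := mem_range.mp hs; omega, Nat.choose_succ_succ,
          mul_add]
      rw [sum_congr rfl this, sum_add_distrib, ih, ih, Nat.choose_succ_succ (m + 1)]
      simp [add_assoc]

theorem sum_range_choose_mul_choose (m n k : ℕ) :
    ∑ j ∈ range (k + 1), m.choose j * n.choose (k - j) = (m + n).choose k := by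
  rw [Nat.add_choose_eq, Nat.sum_antidiagonal_eq_sum_range_succ_mk]

/-- The norm `√(i! (n - i)!)` of the monomial `x^(n-i) y^i` in Bargmann space. -/
def monomialNorm (n i : ℕ) : ℝ := √((i ! : ℝ) * ((n - i)! : ℝ))

theorem monomialNorm_sq (n i : ℕ) : monomialNorm n i ^ 2 = (i ! : ℝ) * ((n - i)! : ℝ) :=
  Real.sq_sqrt (by positivity)

theorem monomialNorm_pos (n i : ℕ) : 0 < monomialNorm n i := Real.sqrt_pos.mpr (by positivity)

theorem monomialNorm_ne_zero (n i : ℕ) : monomialNorm n i ≠ 0 := (monomialNorm_pos n i).ne'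

/-- Coefficient of the normalized monomial number `s` of degree `n + k` in the product of the
normalized monomials number `i` of degree `n` and number `q` of degree `k`. -/
def fusionCoeff (n k s i q : ℕ) : ℝ :=
  if s = i + q then monomialNorm (n + k) s / (monomialNorm n i * monomialNorm k q) else 0

theorem fusionCoeff_of_eq (n k : ℕ) {s i q : ℕ} (h : s = i + q) :
    fusionCoeff n k s i q = monomialNorm (n + k) s / (monomialNorm n i * monomialNorm k q) :=
  if_pos h

theorem fusionCoeff_of_ne (n k : ℕ) {s i q : ℕ} (h : s ≠ i + q) : fusionCoeff n k s i q = 0 :=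
  if_neg h

theorem fusionCoeff_comm (n k s i q : ℕ) : fusionCoeff n k s i q = fusionCoeff k n s q i := by
  unfold fusionCoeff
  rw [add_comm q i, add_comm k n, mul_comm (monomialNorm n i)]

theorem fusionCoeff_sq {n k i q : ℕ} (hi : i ≤ n) (hq : q ≤ k) :
    fusionCoeff n k (i + q) i q ^ 2 = ((i + q).choose i * (n + k - (i + q)).choose (n - i) : ℕ) := by
  rw [fusionCoeff_of_eq n k rfl, div_pow, mul_pow, monomialNorm_sq, monomialNorm_sq,
    monomialNorm_sq, show n + k - (i + q) = (n - i) + (k - q) by omega, Nat.cast_mul,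
    Nat.cast_add_choose, Nat.cast_add_choose]
  field_simp

/-- Vandermonde's identity for one mode, in terms of contingency tables. -/
theorem sum_choose_div_factorial {q q' i i' : ℕ} (h : q + i = q' + i') :
    ∑ j ∈ range (q + 1), ((i'.choose j * q'.choose (q - j) : ℕ) : ℝ) / (i' ! * q' !) =
      ((q + i)! : ℝ) / (q ! * q' ! * i ! * i' !) := by
  rw [← sum_div, ← Nat.cast_sum, sum_range_choose_mul_choose, add_comm i' q', ← h,
    Nat.cast_add_choose]
  field_simp

/-- A 2×2 contingency table with row sums `q, i` and column sums `i', q'` is fixed by one entry `j`.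
Its weight is the product of the inverse factorials of its four entries. -/
theorem choose_div_factorial {q q' i i' j : ℕ} (h : q + i = q' + i') (hj : j ≤ q) (hi : j ≤ i')
    (hq : q ≤ q' + j) :
    ((i'.choose j * q'.choose (q - j) : ℕ) : ℝ) / (i' ! * q' !) =
      1 / (j ! * (q - j)! * (q' + j - q)! * (i' - j)!) := by
  rw [Nat.cast_mul, Nat.cast_choose ℝ hi, Nat.cast_choose ℝ (show q - j ≤ q' by omega),
    show q' - (q - j) = q' + j - q by omega]
  field_simp

/-- Cauchy product of finitely supported sequences: the cutoff `N` loses nothing, as it is at least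
the sum of the two support bounds. -/
theorem sum_range_sum_range_eq_mul (g h : ℕ → ℝ) {N a b : ℕ} (hab : a + b ≤ N)
    (hg : ∀ j, a < j → g j = 0) (hh : ∀ j, b < j → h j = 0) :
    ∑ l ∈ range (N + 1), ∑ j ∈ range (l + 1), g j * h (l - j) =
      (∑ j ∈ range (a + 1), g j) * ∑ j ∈ range (b + 1), h j := by
  rw [sum_mul_sum, ← sum_product', ← sum_fiberwise_of_maps_to (t := range (N + 1))
    (g := fun x : ℕ × ℕ => x.1 + x.2)]
  · refine sum_congr rfl fun l hl => ?_
    rw [← Nat.sum_antidiagonal_eq_sum_range_succ (fun j t => g j * h t) l]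
    symm
    refine sum_subset ?_ ?_
    · intro x hx
      simp only [mem_filter] at hx
      simpa using hx.2
    · intro x hx hx'
      simp only [mem_filter, mem_product, mem_range, not_and] at hx'
      simp only [HasAntidiagonal.mem_antidiagonal] at hx
      by_cases h1 : a < x.1
      · rw [hg _ h1, zero_mul]
      · by_cases h2 : b < x.2
        · rw [hh _ h2, mul_zero]
        · exact absurd hx (hx' ⟨by omega, by omega⟩)
  · intro x hx
    simp only [mem_product, mem_range] at hx ⊢
    omega

/-- The sum over the contraction tables with contracted degree `l` and `j` contracted `y`'s. -/
theorem sum_fusionCoeff_table {n k q q' i i' l j : ℕ} (hq : q ≤ k) (hq' : q' ≤ k) (hi : i ≤ n)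
    (hi' : i' ≤ n) (hs : q + i = q' + i') (hln : l ≤ n) (hlk : l ≤ k) (hj : j ≤ l) :
    ∑ u ∈ range (k - l + 1), ∑ j' ∈ range (l + 1), ∑ p ∈ range (n - l + 1),
      fusionCoeff l (k - l) q j u * fusionCoeff l (k - l) q' j' u *
        (fusionCoeff l (n - l) i' j p * fusionCoeff l (n - l) i j' p) =
    monomialNorm k q * monomialNorm k q' * monomialNorm n i * monomialNorm n i' *
      ((if j ≤ q then ((i'.choose j * q'.choose (q - j) : ℕ) : ℝ) / (i' ! * q' !) else 0) *
       (if l - j ≤ k - q then (((n - i').choose (l - j) * (k - q').choose (k - q - (l - j)) : ℕ) : ℝ)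
          / ((n - i')! * (k - q')!) else 0)) := by
  -- The supports force `u = q - j`, `j' = q' + j - q`, `p = i' - j`. The conditions say that the
  -- resulting tables for both modes have nonnegative entries; otherwise both sides vanish. The
  -- guards `j ≤ q` and `l - j ≤ k - q` are needed because a truncated subtraction would turn a
  -- binomial into `choose _ 0 = 1`.
  by_cases hC : j ≤ q ∧ l - j ≤ k - q ∧ q ≤ q' + j ∧ q' + j - q ≤ l ∧ j ≤ i' ∧ i' - j ≤ n - l
  · obtain ⟨h1, h2, h3, h4, h5, h6⟩ := hC
    rw [sum_eq_single (q - j), sum_eq_single (q' + j - q), sum_eq_single (i' - j)]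
    · rw [if_pos h1, if_pos h2, choose_div_factorial hs h1 h5 h3,
        choose_div_factorial (q := k - q) (q' := k - q') (i := n - i) (i' := n - i') (by omega) h2
          (by omega) (by omega), fusionCoeff_of_eq _ _ (show q = j + (q - j) by omega),
        fusionCoeff_of_eq _ _ (show q' = (q' + j - q) + (q - j) by omega),
        fusionCoeff_of_eq _ _ (show i' = j + (i' - j) by omega),
        fusionCoeff_of_eq _ _ (show i = (q' + j - q) + (i' - j) by omega),
        Nat.add_sub_cancel' hln, Nat.add_sub_cancel' hlk]
      have e1 := monomialNorm_sq l j
      have e2 := monomialNorm_sq l (q' + j - q)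
      have e3 := monomialNorm_sq (k - l) (q - j)
      have e4 := monomialNorm_sq (n - l) (i' - j)
      rw [show k - l - (q - j) = k - q - (l - j) by omega] at e3
      rw [show n - l - (i' - j) = n - i' - (l - j) by omega] at e4
      rw [show l - (q' + j - q) = (k - q') + (l - j) - (k - q) by omega] at e2
      calc _ = monomialNorm k q * monomialNorm k q' * monomialNorm n i * monomialNorm n i' *
            (1 / (monomialNorm l j ^ 2 * monomialNorm l (q' + j - q) ^ 2 *
              monomialNorm (k - l) (q - j) ^ 2 * monomialNorm (n - l) (i' - j) ^ 2)) := by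
            have := monomialNorm_ne_zero l j
            have := monomialNorm_ne_zero l (q' + j - q)
            have := monomialNorm_ne_zero (k - l) (q - j)
            have := monomialNorm_ne_zero (n - l) (i' - j)
            field_simp
        _ = _ := by
            rw [e1, e2, e3, e4]
            field_simp
    · intro p _ hp
      rw [fusionCoeff_of_ne l (n - l) (show i' ≠ j + p by omega)]
      simp
    · intro hp
      simp only [mem_range] at hp
      omega
    · intro j' _ hp
      refine sum_eq_zero fun p _ => ?_
      rw [fusionCoeff_of_ne l (k - l) (show q' ≠ j' + (q - j) by omega)]
      simp
    · intro hp
      simp only [mem_range] at hp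
      omega
    · intro u _ hp
      refine sum_eq_zero fun j' _ => sum_eq_zero fun p _ => ?_
      rw [fusionCoeff_of_ne l (k - l) (show q ≠ j + u by omega)]
      simp
    · intro hp
      simp only [mem_range] at hp
      omega
  · trans 0
    · refine sum_eq_zero fun u hu => sum_eq_zero fun j' hj' => sum_eq_zero fun p hp => ?_
      simp only [mem_range] at hu hj' hp
      by_cases h1 : q = j + u
      · by_cases h2 : q' = j' + u
        · by_cases h3 : i' = j + p
          · exact absurd (by omega) hC
          · rw [fusionCoeff_of_ne l (n - l) h3]; simp
        · rw [fusionCoeff_of_ne l (k - l) h2]; simp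
      · rw [fusionCoeff_of_ne l (k - l) h1]; simp
    · symm
      rw [mul_eq_zero]
      right
      by_cases h1 : j ≤ q
      · by_cases h2 : l - j ≤ k - q
        · rw [if_pos h1, if_pos h2]
          by_cases h5 : j ≤ i'
          · by_cases h3 : q ≤ q' + j
            · by_cases h6 : i' - j ≤ n - l
              · rw [Nat.choose_eq_zero_of_lt (show k - q' < k - q - (l - j) by omega)]
                simp
              · rw [Nat.choose_eq_zero_of_lt (show n - i' < l - j by omega)]
                simp
            · rw [Nat.choose_eq_zero_of_lt (show q' < q - j by omega)]
              simp
          · rw [Nat.choose_eq_zero_of_lt (show i' < j by omega)]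
            simp
        · rw [if_neg h2, mul_zero]
      · rw [if_neg h1, zero_mul]

/-- Matrix elements of the normal ordering identity (Wick's theorem for two modes). -/
theorem sum_fusionCoeff_mul_fusionCoeff {n k q q' i i' : ℕ} (hq : q ≤ k) (hq' : q' ≤ k)
    (hi : i ≤ n) (hi' : i' ≤ n) :
    ∑ s ∈ range (n + k + 1), fusionCoeff n k s i q * fusionCoeff n k s i' q' =
    ∑ l ∈ range (min n k + 1), ∑ j ∈ range (l + 1), ∑ u ∈ range (k - l + 1),
      ∑ j' ∈ range (l + 1), ∑ p ∈ range (n - l + 1),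
      fusionCoeff l (k - l) q j u * fusionCoeff l (k - l) q' j' u *
        (fusionCoeff l (n - l) i' j p * fusionCoeff l (n - l) i j' p) := by
  by_cases hs : q + i = q' + i'
  · rw [sum_eq_single (q + i)]
    · have h1 : ∀ l ∈ range (min n k + 1), ∀ j ∈ range (l + 1), _ = _ := fun l hl j hj =>
        sum_fusionCoeff_table hq hq' hi hi' hs
          (show l ≤ n by have := mem_range.mp hl; omega)
          (show l ≤ k by have := mem_range.mp hl; omega)
          (show j ≤ l by have := mem_range.mp hj; omega)
      rw [sum_congr rfl fun l hl => sum_congr rfl (h1 l hl)]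
      simp_rw [← mul_sum]
      -- The modes decouple: `j` counts the contractions in `y` and `l - j` those in `x`, and each
      -- factor is a Vandermonde sum. The range `l ≤ min n k` covers both supports.
      rw [sum_range_sum_range_eq_mul (a := min q i') (b := min (k - q) (n - i'))
        (fun j => if j ≤ q then ((i'.choose j * q'.choose (q - j) : ℕ) : ℝ) / (i' ! * q' !) else 0)
        (fun j => if j ≤ k - q then
          (((n - i').choose j * (k - q').choose (k - q - j) : ℕ) : ℝ)
          / ((n - i')! * (k - q')!) else 0) (by omega)]
      · have e : ∀ (q i' q' : ℕ), ∑ j ∈ range (min q i' + 1),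
            (if j ≤ q then ((i'.choose j * q'.choose (q - j) : ℕ) : ℝ) / (i' ! * q' !) else 0) =
            ∑ j ∈ range (q + 1), ((i'.choose j * q'.choose (q - j) : ℕ) : ℝ) / (i' ! * q' !) := by
          intro q i' q'
          rw [← sum_subset (range_subset_range.mpr (show min q i' + 1 ≤ q + 1 by omega))]
          · refine sum_congr rfl fun j hj => if_pos ?_
            have := mem_range.mp hj
            omega
          · intro j hj hj'
            simp only [mem_range] at hj hj'
            rw [Nat.choose_eq_zero_of_lt (show i' < j by omega)]
            simp
        rw [e, e, sum_choose_div_factorial hs,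
          sum_choose_div_factorial (i := n - i) (show k - q + (n - i) = k - q' + (n - i') by omega),
          fusionCoeff_of_eq n k (show q + i = i + q by omega),
          fusionCoeff_of_eq n k (show q + i = i' + q' by omega)]
        have e0 := monomialNorm_sq (n + k) (q + i)
        have e1 := monomialNorm_sq n i
        have e2 := monomialNorm_sq n i'
        have e3 := monomialNorm_sq k q
        have e4 := monomialNorm_sq k q'
        rw [show n + k - (q + i) = k - q + (n - i) by omega] at e0
        have := monomialNorm_ne_zero n i
        have := monomialNorm_ne_zero n i'
        have := monomialNorm_ne_zero k q
        have := monomialNorm_ne_zero k q'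
        calc _ = monomialNorm (n + k) (q + i) ^ 2 / (monomialNorm n i * monomialNorm n i' *
              monomialNorm k q * monomialNorm k q') := by field_simp
          _ = (monomialNorm k q * monomialNorm k q' * monomialNorm n i * monomialNorm n i') *
              (monomialNorm (n + k) (q + i) ^ 2 / (monomialNorm n i ^ 2 * monomialNorm n i' ^ 2 *
              monomialNorm k q ^ 2 * monomialNorm k q' ^ 2)) := by field_simp
          _ = _ := by
            rw [e0, e1, e2, e3, e4]
            field_simp
      · intro j hj
        by_cases h : j ≤ q
        · rw [if_pos h, Nat.choose_eq_zero_of_lt (show i' < j by omega)]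
          simp
        · rw [if_neg h]
      · intro j hj
        by_cases h : j ≤ k - q
        · rw [if_pos h, Nat.choose_eq_zero_of_lt (show n - i' < j by omega)]
          simp
        · rw [if_neg h]
    · intro s _ hne
      rw [fusionCoeff_of_ne n k (show s ≠ i + q by omega), zero_mul]
    · intro h
      simp only [mem_range] at h
      omega
  · trans 0
    · refine sum_eq_zero fun s _ => ?_
      by_cases h : s = i + q
      · rw [fusionCoeff_of_ne n k (show s ≠ i' + q' by omega), mul_zero]
      · rw [fusionCoeff_of_ne n k h, zero_mul]
    · symm
      refine sum_eq_zero fun l _ => sum_eq_zero fun j _ => sum_eq_zero fun u _ =>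
        sum_eq_zero fun j' _ => sum_eq_zero fun p _ => ?_
      by_cases h1 : q = j + u
      · by_cases h2 : q' = j' + u
        · by_cases h3 : i' = j + p
          · rw [fusionCoeff_of_ne l (n - l) (show i ≠ j' + p by omega)]; simp
          · rw [fusionCoeff_of_ne l (n - l) h3]; simp
        · rw [fusionCoeff_of_ne l (k - l) h2]; simp
      · rw [fusionCoeff_of_ne l (k - l) h1]; simp

/-- The products with a fixed monomial of degree `k` have total weight `C(n + k + 1, k + 1)`. -/
theorem sum_fusionCoeff_col {n k q q' : ℕ} (hq : q ≤ k) (hq' : q' ≤ k) :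
    ∑ s ∈ range (n + k + 1), ∑ i ∈ range (n + 1), fusionCoeff n k s i q * fusionCoeff n k s i q' =
      if q = q' then ((n + k + 1).choose (k + 1) : ℝ) else 0 := by
  split_ifs with h
  · subst h
    -- For fixed `s` only `i = s - q` contributes, with weight `C(s, q) C(n + k - s, k - q)`.
    rw [show k + 1 = q + (k - q) + 1 by omega, ← sum_choose_mul_choose_sub, Nat.cast_sum]
    refine sum_congr rfl fun s hs => ?_
    have hs' := mem_range.mp hs
    by_cases h : q ≤ s ∧ s - q ≤ n
    · rw [sum_eq_single (s - q), ← sq, fusionCoeff_comm]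
      · nth_rw 1 [show s = q + (s - q) by omega]
        rw [fusionCoeff_sq hq h.2, show q + (s - q) = s by omega]
        congr 3
        omega
      · intro i _ hne
        rw [fusionCoeff_of_ne n k (show s ≠ i + q by omega), zero_mul]
      · intro h'
        simp only [mem_range] at h'
        omega
    · rw [sum_eq_zero]
      · by_cases h1 : q ≤ s
        · rw [Nat.choose_eq_zero_of_lt (show n + k - s < k - q by omega)]
          simp
        · rw [Nat.choose_eq_zero_of_lt (show s < q by omega)]
          simp
      · intro i hi
        rw [fusionCoeff_of_ne n k (show s ≠ i + q by have := mem_range.mp hi; omega), zero_mul]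
  · refine sum_eq_zero fun s _ => sum_eq_zero fun i _ => ?_
    by_cases h1 : s = i + q
    · rw [fusionCoeff_of_ne n k (show s ≠ i + q' by omega), mul_zero]
    · rw [fusionCoeff_of_ne n k h1, zero_mul]

/-- The factorizations of a fixed monomial of degree `n` have total weight `C(n, l)`. -/
theorem sum_fusionCoeff_row {n l i i' : ℕ} (hl : l ≤ n) (hi : i ≤ n) :
    ∑ j ∈ range (l + 1), ∑ p ∈ range (n - l + 1),
      fusionCoeff l (n - l) i j p * fusionCoeff l (n - l) i' j p =
      if i = i' then (n.choose l : ℝ) else 0 := by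
  split_ifs with h
  · subst h
    have h0 : n.choose l = (i + (n - i)).choose l := by rw [Nat.add_sub_cancel' hi]
    rw [h0, ← sum_range_choose_mul_choose, Nat.cast_sum]
    refine sum_congr rfl fun j hj => ?_
    have hj' := mem_range.mp hj
    by_cases h : j ≤ i ∧ i - j ≤ n - l
    · rw [sum_eq_single (i - j), ← sq]
      · nth_rw 1 [show i = j + (i - j) by omega]
        rw [fusionCoeff_sq (by omega) h.2, show j + (i - j) = i by omega,
          Nat.add_sub_cancel' hl]
      · intro p _ hne
        rw [fusionCoeff_of_ne _ _ (show i ≠ j + p by omega), zero_mul]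
      · intro h'
        simp only [mem_range] at h'
        omega
    · rw [sum_eq_zero]
      · by_cases h1 : j ≤ i
        · rw [Nat.choose_eq_zero_of_lt (show n - i < l - j by omega)]
          simp
        · rw [Nat.choose_eq_zero_of_lt (show i < j by omega)]
          simp
      · intro p hp
        rw [fusionCoeff_of_ne _ _ (show i ≠ j + p by have := mem_range.mp hp; omega), zero_mul]
  · refine sum_eq_zero fun j _ => sum_eq_zero fun p _ => ?_
    by_cases h1 : i = j + p
    · rw [fusionCoeff_of_ne _ _ (show i' ≠ j + p by omega), mul_zero]
    · rw [fusionCoeff_of_ne _ _ h1, zero_mul]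

end Combinatorics

/-! ### The cloning map: normal ordering and the induction on the output degree -/

section Cloning

/-- The unnormalized cloning map `ρ ↦ W (ρ ⊗ I) W*`, with `W` the product map from degree `n` times
degree `k` to degree `m = n + k`. -/
def cloning (n k m : ℕ) (ρ : SpinOp n) : SpinOp m :=
  Matrix.of fun s s' => ∑ q : Fin (k + 1), ∑ i : Fin (n + 1), ∑ i' : Fin (n + 1),
    (fusionCoeff n k s i q : ℂ) * (fusionCoeff n k s' i' q : ℂ) * ρ i i'

/-- Multiplication by the polynomial with coefficient vector `ψ`. -/
def fusionMat (n k m : ℕ) (ψ : Fin (n + 1) → ℂ) : Matrix (Fin (m + 1)) (Fin (k + 1)) ℂ :=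
  Matrix.of fun s q => ∑ i : Fin (n + 1), (fusionCoeff n k s i q : ℂ) * ψ i

/-- The splitting of the polynomial with coefficient vector `ψ` into degrees `l` and `n - l`. -/
def splitMat (n l : ℕ) (ψ : Fin (n + 1) → ℂ) : Matrix (Fin (l + 1)) (Fin (n - l + 1)) ℂ :=
  Matrix.of fun j p => ∑ i : Fin (n + 1), (fusionCoeff l (n - l) i j p : ℂ) * ψ i

theorem cloning_sum {α : Type*} (n k m : ℕ) (S : Finset α) (ρ : α → SpinOp n) :
    cloning n k m (∑ a ∈ S, ρ a) = ∑ a ∈ S, cloning n k m (ρ a) := by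
  ext s s'
  simp only [cloning, of_apply, Matrix.sum_apply, mul_sum]
  symm
  rw [sum_comm]
  refine sum_congr rfl fun q _ => ?_
  rw [sum_comm]
  refine sum_congr rfl fun i _ => ?_
  rw [sum_comm]

theorem cloning_vecMulVec (n k m : ℕ) (ψ : Fin (n + 1) → ℂ) :
    cloning n k m (vecMulVec ψ (star ψ)) = fusionMat n k m ψ * (fusionMat n k m ψ)ᴴ := by
  ext s s'
  simp only [cloning, fusionMat, of_apply, mul_apply, conjTranspose_apply, star_sum, star_mul',
    sum_mul_sum, vecMulVec_apply, Pi.star_apply, Complex.star_def, Complex.conj_ofReal]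
  refine sum_congr rfl fun q _ => sum_congr rfl fun i _ => sum_congr rfl fun i' _ => ?_
  ring

/-- Wick's theorem for `ψ̄(a) ψ(a*)` on degree `k`: contract `n - l` particles of `ψ` with those of
its conjugate and leave `l` to act. This drives the recursion, since every term is again a cloning
map, with the smaller output degree `k`. -/
theorem conjTranspose_fusionMat_mul_fusionMat (n k : ℕ) (ψ : Fin (n + 1) → ℂ) :
    (fusionMat n k (n + k) ψ)ᴴ * fusionMat n k (n + k) ψ =
      ∑ l ∈ range (min n k + 1), cloning l (k - l) k (splitMat n l ψ * (splitMat n l ψ)ᴴ) := by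
  ext q q'
  -- Pairing with `ψ̄ ⊗ ψ`, as an additive map, so that the identity between monomial matrix
  -- elements can be contracted under all the sums at once.
  let L : (Fin (n + 1) → Fin (n + 1) → ℂ) →+ ℂ :=
    { toFun := fun f => ∑ i, ∑ i', star (ψ i) * ψ i' * f i i'
      map_zero' := by simp
      map_add' := fun f g => by simp [mul_add, sum_add_distrib] }
  have hL : ∀ f, L f = ∑ i, ∑ i', star (ψ i) * ψ i' * f i i' := fun _ => rfl
  have key : (∑ s : Fin (n + k + 1), fun i i' : Fin (n + 1) =>
      (fusionCoeff n k s i q : ℂ) * (fusionCoeff n k s i' q' : ℂ)) =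
      ∑ l ∈ range (min n k + 1), ∑ j : Fin (l + 1), ∑ u : Fin (k - l + 1), ∑ j' : Fin (l + 1),
      ∑ p : Fin (n - l + 1), fun i i' : Fin (n + 1) =>
      (fusionCoeff l (k - l) q j u : ℂ) * fusionCoeff l (k - l) q' j' u *
        (fusionCoeff l (n - l) i' j p * fusionCoeff l (n - l) i j' p) := by
    ext i i'
    have h := sum_fusionCoeff_mul_fusionCoeff (Fin.is_le q) (Fin.is_le q') (Fin.is_le i)
      (Fin.is_le i')
    simp only [← Fin.sum_univ_eq_sum_range] at h
    simp only [Finset.sum_apply]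
    rw [Fin.sum_univ_eq_sum_range (fun l => ∑ j : Fin (l + 1), ∑ u : Fin (k - l + 1),
      ∑ j' : Fin (l + 1), ∑ p : Fin (n - l + 1),
      fusionCoeff l (k - l) q j u * fusionCoeff l (k - l) q' j' u *
        (fusionCoeff l (n - l) i' j p * fusionCoeff l (n - l) i j' p))] at h
    exact_mod_cast congrArg (fun x : ℝ => (x : ℂ)) h
  have key2 := congrArg L key
  simp only [map_sum] at key2
  calc _ = ∑ s : Fin (n + k + 1), L fun i i' : Fin (n + 1) =>
      (fusionCoeff n k s i q : ℂ) * (fusionCoeff n k s i' q' : ℂ) := by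
        simp only [fusionMat, of_apply, mul_apply, conjTranspose_apply, star_sum, star_mul',
          sum_mul_sum, Complex.star_def, Complex.conj_ofReal, hL]
        refine sum_congr rfl fun s _ => sum_congr rfl fun i _ => sum_congr rfl fun i' _ => ?_
        ring
    _ = _ := key2
    _ = _ := by
        rw [Matrix.sum_apply]
        refine sum_congr rfl fun l _ => ?_
        rw [sum_comm]
        simp only [cloning, splitMat, of_apply, mul_apply, conjTranspose_apply, star_sum, star_mul',
          Complex.star_def, Complex.conj_ofReal, hL, mul_sum]
        refine sum_congr rfl fun u _ => sum_congr rfl fun j _ => sum_congr rfl fun j' _ =>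
          sum_congr rfl fun p _ => ?_
        refine sum_congr rfl fun i _ => ?_
        rw [sum_mul, mul_sum]
        refine sum_congr rfl fun i' _ => ?_
        ring

/-- Splitting is `√C(n,l)` times an isometry. As this depends on `ψ` only through its norm, the
inductive bounds are the same for all unit vectors. -/
theorem trace_splitMat_mul_conjTranspose {n l : ℕ} (hl : l ≤ n) (ψ : Fin (n + 1) → ℂ) :
    (splitMat n l ψ * (splitMat n l ψ)ᴴ).trace = n.choose l * ∑ i, ψ i * star (ψ i) := by
  simp only [trace, diag_apply, splitMat, of_apply, mul_apply, conjTranspose_apply, star_sum,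
    star_mul', sum_mul_sum, Complex.star_def, Complex.conj_ofReal]
  calc _ = ∑ i, ∑ i', ψ i * star (ψ i') * ((∑ j : Fin (l + 1), ∑ p : Fin (n - l + 1),
        fusionCoeff l (n - l) i j p * fusionCoeff l (n - l) i' j p : ℝ) : ℂ) := by
        push_cast
        simp only [mul_sum]
        calc _ = ∑ j : Fin (l + 1), ∑ i, ∑ p : Fin (n - l + 1), ∑ i', _ :=
              sum_congr rfl fun j _ => sum_comm
          _ = ∑ i, ∑ j : Fin (l + 1), ∑ p : Fin (n - l + 1), ∑ i', _ := sum_comm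
          _ = ∑ i, ∑ j : Fin (l + 1), ∑ i', ∑ p : Fin (n - l + 1), _ :=
              sum_congr rfl fun i _ => sum_congr rfl fun j _ => sum_comm
          _ = ∑ i, ∑ i', ∑ j : Fin (l + 1), ∑ p : Fin (n - l + 1), _ :=
              sum_congr rfl fun i _ => sum_comm
          _ = _ := by
              refine sum_congr rfl fun i _ => sum_congr rfl fun i' _ => sum_congr rfl fun j _ =>
                sum_congr rfl fun p _ => ?_
              rw [Complex.star_def]
              ring
    _ = _ := by
        rw [mul_sum]
        refine sum_congr rfl fun i _ => ?_
        have h : ∀ i' : Fin (n + 1), (∑ j : Fin (l + 1), ∑ p : Fin (n - l + 1),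
            fusionCoeff l (n - l) i j p * fusionCoeff l (n - l) i' j p) =
            if i = i' then (n.choose l : ℝ) else 0 := by
          intro i'
          have h := sum_fusionCoeff_row (i' := i') hl (Fin.is_le i)
          simp only [← Fin.sum_univ_eq_sum_range] at h
          rw [h]
          simp only [Fin.ext_iff]
        simp only [h]
        rw [sum_eq_single i]
        · simp
          ring
        · intro i' _ hne
          rw [if_neg hne.symm]
          simp
        · simp

theorem cloning_zero (k : ℕ) (ρ : SpinOp 0) : cloning 0 k k ρ = ρ.trace • (1 : SpinOp k) := by
  ext s s'
  simp only [cloning, of_apply, trace, diag_apply]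
  have h : ∀ s q : ℕ, fusionCoeff 0 k s 0 q = if s = q then 1 else 0 := by
    intro s q
    unfold fusionCoeff
    rw [zero_add, zero_add]
    split_ifs with h
    · subst h
      have := monomialNorm_ne_zero k s
      field_simp
      simp [monomialNorm]
    · rfl
  simp [h, Matrix.one_apply, Fin.val_inj, apply_ite Complex.ofReal]

/-- Vandermonde's identity after the reflection `l ↦ n - l`. -/
theorem sum_choose_mul_choose_min (n k s : ℕ) :
    ∑ l ∈ range (min n k + 1), n.choose l * (k - s).choose l = (n + (k - s)).choose n := by
  rw [← sum_range_choose_mul_choose,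
    sum_subset (range_subset_range.mpr (show min n k + 1 ≤ n + 1 by omega)), ← sum_range_reflect]
  · refine sum_congr rfl fun l hl => ?_
    have := mem_range.mp hl
    rw [show n + 1 - 1 - l = n - l by omega, Nat.choose_symm (by omega)]
  · intro l hl hl'
    simp only [mem_range] at hl hl'
    rw [Nat.choose_eq_zero_of_lt (show k - s < l by omega), mul_zero]

/-- Partial sums of the spectrum of the cloned coherent state, one step of the recursion. -/
theorem sum_choose_recursion (n k r : ℕ) (hn : n ≠ 0) :
    ∑ l ∈ range (min n k + 1), (n.choose l : ℝ) *
      ∑ s : Fin (k + 1) with s.val < r, ((k - s.val).choose l : ℝ) =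
      ∑ s : Fin (n + k + 1) with s.val < r, ((n + k - s.val).choose n : ℝ) := by
  simp only [sum_filter]
  rw [Fin.sum_univ_eq_sum_range (fun s => if s < r then ((n + k - s).choose n : ℝ) else 0),
    ← sum_subset (range_subset_range.mpr (show k + 1 ≤ n + k + 1 by omega)),
    sum_congr rfl fun l _ => by
      rw [Fin.sum_univ_eq_sum_range (fun s => if s < r then ((k - s).choose l : ℝ) else 0)]]
  · simp only [mul_sum]
    rw [sum_comm]
    refine sum_congr rfl fun s hs => ?_
    have := mem_range.mp hs
    split_ifs
    · rw [show n + k - s = n + (k - s) by omega, ← sum_choose_mul_choose_min]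
      push_cast
      rfl
    · simp
  · intro s _ hs
    simp only [mem_range] at hs
    rw [Nat.choose_eq_zero_of_lt (by omega)]
    simp

theorem kyFanLE_smul_one (m r : ℕ) {c : ℝ} (hc : 0 ≤ c) :
    KyFanLE ((c : ℂ) • (1 : SpinOp m)) r (c * ∑ s : Fin (m + 1) with s.val < r, (1 : ℝ)) := by
  refine KyFanLE.smul hc ?_
  intro X h1 h2 h3
  rw [Matrix.mul_one]
  by_cases hr : r ≤ m + 1
  · refine h3.trans (le_of_eq ?_)
    rw [sum_filter, Fin.sum_univ_eq_sum_range (fun s => if s < r then (1 : ℝ) else 0), ← sum_filter,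
      show (range (m + 1)).filter (· < r) = range r by ext; simp; omega]
    simp
  · refine (trace_re_le_card_of_isProj h1 h2).trans (le_of_eq ?_)
    rw [filter_true_of_mem fun s _ => by omega]
    simp

-- Factor `ρ = B* B` and collect the rows of `B`. This reduces bounds for mixed states to rank-one
-- ones; the vectors need not be orthogonal.
open scoped MatrixOrder Matrix.Norms.L2Operator in
theorem posSemidef_eq_sum_vecMulVec {ι : Type*} [Fintype ι] {ρ : Matrix ι ι ℂ}
    (h : ρ.PosSemidef) : ∃ ψ : ι → ι → ℂ, ρ = ∑ p, vecMulVec (ψ p) (star (ψ p)) := by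
  classical
  obtain ⟨B, rfl⟩ := CStarAlgebra.nonneg_iff_eq_star_mul_self.mp h.nonneg
  refine ⟨fun p i => star (B p i), ?_⟩
  ext i j
  simp [mul_apply, Matrix.sum_apply, vecMulVec_apply, star_apply]

/-- Ky Fan bounds for the cloning map; they are attained at coherent states. -/
theorem kyFanLE_cloning (m : ℕ) : ∀ n k : ℕ, n + k = m → ∀ ρ : SpinOp n, ρ.PosSemidef → ∀ r : ℕ,
    KyFanLE (cloning n k m ρ) r
      (ρ.trace.re * ∑ s : Fin (m + 1) with s.val < r, ((m - s.val).choose n : ℝ)) := by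
  induction m using Nat.strong_induction_on with
  | _ m ih =>
    intro n k hm ρ hρ r
    have htr : ρ.trace = (ρ.trace.re : ℂ) := by
      have := (Complex.nonneg_iff.mp hρ.trace_nonneg).2
      exact Complex.ext rfl (by simp [← this])
    -- For `n = 0` passing to `M* M` would not lower the degree, so this is the base case.
    by_cases hn : n = 0
    · subst hn
      obtain rfl : k = m := by omega
      rw [cloning_zero, htr]
      simpa using kyFanLE_smul_one k r (Complex.nonneg_iff.mp hρ.trace_nonneg).1
    subst hm
    obtain ⟨ψ, rfl⟩ := posSemidef_eq_sum_vecMulVec hρ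
    rw [cloning_sum, trace_sum, Complex.re_sum, sum_mul]
    refine KyFanLE.sum _ fun p _ => ?_
    rw [cloning_vecMulVec]
    -- From `M M*` in degree `n + k` to `M* M` in degree `k < n + k`.
    refine KyFanLE.gram ?_
    rw [conjTranspose_fusionMat_mul_fusionMat, ← sum_choose_recursion n k r hn, mul_sum]
    refine KyFanLE.sum _ fun l hl => ?_
    have hl' := mem_range.mp hl
    have := ih k (by omega) l (k - l) (by omega) (splitMat n l (ψ p) * (splitMat n l (ψ p))ᴴ)
      (posSemidef_self_mul_conjTranspose _) r
    rw [trace_splitMat_mul_conjTranspose (by omega)] at this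
    convert this using 1
    rw [← mul_assoc]
    congr 1
    rw [trace_vecMulVec, ← Complex.ofReal_natCast, Complex.re_ofReal_mul, mul_comm]
    rfl

end Cloning

/-! ### Algebraic characterization of eigenspace projections -/

section EigenProj

variable {ι : Type*} [Fintype ι]

/-- `P` is the orthogonal projection onto the eigenspace of `A` with eigenvalue `c`. -/
structure IsEigenProj (A : Matrix ι ι ℂ) (c : ℂ) (P : Matrix ι ι ℂ) : Prop where
  isHermitian : P.IsHermitian
  mul_self : P * P = P
  mul_eq : A * P = c • P
  mulVec_eq : ∀ v : ι → ℂ, A *ᵥ v = c • v → P *ᵥ v = v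

theorem isEigenProj_eigenProj [DecidableEq ι] (A : Matrix ι ι ℂ) (c : ℂ) : IsEigenProj A c (eigenProj A c) := by
  set S := (Module.End.eigenspace (Matrix.toEuclideanLin A) c).starProjection with hS
  set e := Matrix.toEuclideanCLM (n := ι) (𝕜 := ℂ) with he
  have heP : e (eigenProj A c) = S := e.apply_symm_apply S
  have hmem : ∀ v, e A (S v) = c • S v := fun v =>
    Module.End.mem_eigenspace_iff.mp (Submodule.starProjection_apply_mem _ v)
  refine ⟨?_, ?_, ?_, ?_⟩
  · apply EquivLike.injective e
    rw [← star_eq_conjTranspose, map_star, heP]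
    exact isSelfAdjoint_starProjection _
  · apply EquivLike.injective e
    rw [map_mul, heP]
    exact Submodule.isIdempotentElem_starProjection _
  · apply EquivLike.injective e
    rw [map_mul, map_smul, heP]
    ext1 v
    exact hmem v
  · intro v hv
    have h1 : WithLp.toLp 2 v ∈ Module.End.eigenspace (Matrix.toEuclideanLin A) c := by
      rw [Module.End.mem_eigenspace_iff]
      ext i
      exact congrFun hv i
    have h2 : e (eigenProj A c) (WithLp.toLp 2 v) = WithLp.toLp 2 v := by
      rw [heP]
      exact Submodule.starProjection_eq_self_iff.mpr h1
    exact congrArg WithLp.ofLp h2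

theorem IsEigenProj.mul_eq_right {A P Q : Matrix ι ι ℂ} {c : ℂ} (hP : IsEigenProj A c P)
    (hQ : IsEigenProj A c Q) : P * Q = Q := by
  ext i j
  have h : A *ᵥ Q.col j = c • Q.col j := by
    ext i
    exact congrFun (congrFun hQ.mul_eq i) j
  exact congrFun (hP.mulVec_eq _ h) i

/-- Each projection fixes the range of the other, so `P Q = Q` and `Q P = P`; take adjoints. -/
theorem IsEigenProj.unique {A P Q : Matrix ι ι ℂ} {c : ℂ} (hP : IsEigenProj A c P)
    (hQ : IsEigenProj A c Q) : P = Q := by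
  have h1 := congrArg conjTranspose (hP.mul_eq_right hQ)
  rw [conjTranspose_mul, hP.isHermitian.eq, hQ.isHermitian.eq, hQ.mul_eq_right hP] at h1
  exact h1

theorem IsEigenProj.eigenProj_eq [DecidableEq ι] {A P : Matrix ι ι ℂ} {c : ℂ} (hP : IsEigenProj A c P) :
    eigenProj A c = P :=
  (isEigenProj_eigenProj A c).unique hP

theorem IsEigenProj.submatrix {κ : Type*} [Fintype κ] {A P : Matrix ι ι ℂ} {c : ℂ}
    (hP : IsEigenProj A c P) (e : κ ≃ ι) : IsEigenProj (A.submatrix e e) c (P.submatrix e e) := by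
  refine ⟨hP.isHermitian.submatrix e, ?_, ?_, ?_⟩
  · rw [submatrix_mul_equiv, hP.mul_self]
  · rw [submatrix_mul_equiv, hP.mul_eq]
    rfl
  · intro v hv
    rw [submatrix_mulVec_equiv] at hv ⊢
    rw [hP.mulVec_eq]
    · ext; simp
    · ext i
      have := congrFun hv (e.symm i)
      simpa using this

theorem IsEigenProj.conj [DecidableEq ι] {A P U : Matrix ι ι ℂ} {c : ℂ} (hP : IsEigenProj A c P)
    (hU : Uᴴ * U = 1) (hU' : U * Uᴴ = 1) : IsEigenProj (U * A * Uᴴ) c (U * P * Uᴴ) := by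
  have key : ∀ B C : Matrix ι ι ℂ, (U * B * Uᴴ) * (U * C * Uᴴ) = U * (B * C) * Uᴴ := by
    intro B C
    calc _ = U * B * (Uᴴ * U) * C * Uᴴ := by simp only [Matrix.mul_assoc]
      _ = _ := by rw [hU, Matrix.mul_one, Matrix.mul_assoc U]
  refine ⟨isHermitian_mul_mul_conjTranspose _ hP.isHermitian, ?_, ?_, ?_⟩
  · rw [key, hP.mul_self]
  · rw [key, hP.mul_eq, Matrix.mul_smul, Matrix.smul_mul]
  · intro v hv
    have h1 : A *ᵥ (Uᴴ *ᵥ v) = c • (Uᴴ *ᵥ v) := by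
      rw [← mulVec_smul, ← hv, mulVec_mulVec, mulVec_mulVec, ← Matrix.mul_assoc, ← Matrix.mul_assoc,
        hU, Matrix.one_mul]
    rw [← mulVec_mulVec, ← mulVec_mulVec, hP.mulVec_eq _ h1, mulVec_mulVec, hU', one_mulVec]

/-- The eigenspace as the kernel of `K`, where `A - c = Kᴴ K`, with orthogonal frame `V`. -/
theorem isEigenProj_of_frame [DecidableEq ι] {κ α : Type*} [Fintype κ] [Fintype α] [DecidableEq α]
    {A : Matrix ι ι ℂ} {c : ℂ} {K : Matrix κ ι ℂ} {V : Matrix ι α ℂ} {N : ℝ}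
    (hA : A = Kᴴ * K + c • 1) (hN : N ≠ 0) (hV : Vᴴ * V = (N : ℂ) • 1) (hKV : K * V = 0)
    (hker : ∀ v : ι → ℂ, K *ᵥ v = 0 → ∃ y, v = V *ᵥ y) :
    IsEigenProj A c ((N : ℂ)⁻¹ • (V * Vᴴ)) := by
  have hN' : (N : ℂ) ≠ 0 := by exact_mod_cast hN
  have hVV : V * Vᴴ * V = (N : ℂ) • V := by
    rw [Matrix.mul_assoc, hV, Matrix.mul_smul, Matrix.mul_one]
  refine ⟨?_, ?_, ?_, ?_⟩
  · rw [IsHermitian, conjTranspose_smul, conjTranspose_mul, conjTranspose_conjTranspose]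
    simp
  · rw [Matrix.smul_mul, Matrix.mul_smul, ← Matrix.mul_assoc, hVV, Matrix.smul_mul,
      smul_smul (N : ℂ)⁻¹ (N : ℂ), inv_mul_cancel₀ hN', one_smul]
  · rw [hA, Matrix.add_mul, Matrix.mul_smul, Matrix.mul_assoc, ← Matrix.mul_assoc K V, hKV]
    simp [smul_comm c]
  · intro v hv
    have h1 : (Kᴴ * K) *ᵥ v = 0 := by
      rw [hA, add_mulVec, smul_mulVec, one_mulVec] at hv
      exact add_eq_right.mp hv
    obtain ⟨y, rfl⟩ := hker v ((conjTranspose_mul_self_mulVec_eq_zero K v).mp h1)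
    rw [mulVec_mulVec, Matrix.smul_mul, hVV, smul_smul, inv_mul_cancel₀ hN', one_smul]

end EigenProj

/-! ### The total spin squared in terms of Schwinger bosons -/

section Casimir

theorem sum_ite_eq_val {M : Type*} [AddCommMonoid M] {N : ℕ} (c : ℕ) (f : Fin N → M) :
    ∑ a : Fin N, (if c = (a : ℕ) then f a else 0) = if h : c < N then f ⟨c, h⟩ else 0 := by
  split_ifs with h
  · rw [Fintype.sum_eq_single ⟨c, h⟩]
    · simp
    · intro a ha
      rw [if_neg]
      rintro rfl
      exact ha rfl
  · refine sum_eq_zero fun a _ => if_neg ?_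
    omega

/-- Annihilation operator of the spin-up mode. -/
def annihUp (n : ℕ) : Matrix (Fin n) (Fin (n + 1)) ℂ :=
  Matrix.of fun i j => if (i : ℕ) = j then ((√((n : ℝ) - j) : ℝ) : ℂ) else 0

/-- Annihilation operator of the spin-down mode. -/
def annihDown (n : ℕ) : Matrix (Fin n) (Fin (n + 1)) ℂ :=
  Matrix.of fun i j => if (i : ℕ) + 1 = j then ((√(j : ℝ) : ℝ) : ℂ) else 0

/-- The operator moving one particle from the first to the second factor. -/
def hopping (n m : ℕ) : Matrix (Fin n × Fin (m + 2)) (Fin (n + 1) × Fin (m + 1)) ℂ :=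
  annihUp n ⊗ₖ (annihUp (m + 1))ᴴ + annihDown n ⊗ₖ (annihDown (m + 1))ᴴ

theorem ofReal_sqrt_mul_self {x : ℝ} (hx : 0 ≤ x) : ((√x : ℝ) : ℂ) * ((√x : ℝ) : ℂ) = (x : ℂ) := by
  rw [← Complex.ofReal_mul, Real.mul_self_sqrt hx]

theorem annihUp_conjTranspose_mul_self (n : ℕ) :
    (annihUp n)ᴴ * annihUp n = diagonal fun i : Fin (n + 1) => (n : ℂ) - (i : ℕ) := by
  ext i j
  simp only [annihUp, mul_apply, conjTranspose_apply, of_apply, diagonal_apply]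
  simp only [eq_comm (b := (i : ℕ)), eq_comm (b := (j : ℕ)), mul_ite, mul_zero]
  rw [sum_ite_eq_val (j : ℕ)]
  have hi := i.is_lt
  have hj := j.is_lt
  have hn : (0 : ℝ) ≤ n - (j : ℕ) := by
    rw [sub_nonneg]; exact_mod_cast Fin.is_le j
  by_cases h : i = j
  · subst h
    by_cases h' : (i : ℕ) < n
    · simp [h', ofReal_sqrt_mul_self hn]
    · have : n = (i : ℕ) := by omega
      rw [dif_neg h', if_pos rfl, ← this, sub_self]
  · have h' : (i : ℕ) ≠ j := fun h' => h (Fin.ext h')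
    simp [h, h']

theorem annihDown_conjTranspose_mul_self (n : ℕ) :
    (annihDown n)ᴴ * annihDown n = diagonal fun i : Fin (n + 1) => ((i : ℕ) : ℂ) := by
  ext i j
  simp only [annihDown, mul_apply, conjTranspose_apply, of_apply, diagonal_apply]
  have hi := i.is_lt
  have hj := j.is_lt
  have hn : (0 : ℝ) ≤ (j : ℕ) := by positivity
  by_cases h : i = j
  · subst h
    by_cases h' : (i : ℕ) = 0
    · rw [sum_eq_zero]
      · simp [h']
      · intro x _
        rw [if_neg (by omega)]
        simp
    · rw [Fintype.sum_eq_single ⟨i - 1, by omega⟩]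
      · simp [show (i : ℕ) - 1 + 1 = i by omega, ofReal_sqrt_mul_self hn]
      · intro x hx
        rw [if_neg]
        · simp
        · intro h
          exact hx (Fin.ext (by simp; omega))
  · have h' : (i : ℕ) ≠ j := fun h' => h (Fin.ext h')
    rw [if_neg h, sum_eq_zero]
    intro x _
    by_cases h1 : (x : ℕ) + 1 = i
    · rw [if_neg (show ¬ (x : ℕ) + 1 = j by omega), mul_zero]
    · rw [if_neg h1, star_zero, zero_mul]

theorem annihUp_mul_conjTranspose_self (m : ℕ) :
    annihUp (m + 1) * (annihUp (m + 1))ᴴ =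
      diagonal fun i : Fin (m + 1) => (m : ℂ) + 1 - (i : ℕ) := by
  ext i j
  simp only [annihUp, mul_apply, conjTranspose_apply, of_apply, diagonal_apply, ite_mul, zero_mul]
  have hi := i.is_lt
  have hn : (0 : ℝ) ≤ (m : ℝ) + 1 - (i : ℕ) := by
    rw [sub_nonneg]; exact_mod_cast hi.le
  rw [sum_ite_eq_val (i : ℕ), dif_pos (by omega)]
  by_cases h : i = j
  · subst h
    simp [ofReal_sqrt_mul_self hn]
  · have h' : (j : ℕ) ≠ i := fun h' => h (Fin.ext h'.symm)
    simp [h, h']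

theorem annihDown_mul_conjTranspose_self (m : ℕ) :
    annihDown (m + 1) * (annihDown (m + 1))ᴴ =
      diagonal fun i : Fin (m + 1) => ((i : ℕ) : ℂ) + 1 := by
  ext i j
  simp only [annihDown, mul_apply, conjTranspose_apply, of_apply, diagonal_apply, ite_mul, zero_mul]
  have hi := i.is_lt
  have hn : (0 : ℝ) ≤ ((i : ℕ) : ℝ) + 1 := by positivity
  rw [sum_ite_eq_val ((i : ℕ) + 1), dif_pos (by omega)]
  by_cases h : i = j
  · subst h
    simp [ofReal_sqrt_mul_self hn]
  · have h' : (j : ℕ) ≠ i := fun h' => h (Fin.ext h'.symm)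
    simp [h, h']

/-- Schwinger's representation `S₊ = a_↑* a_↓`. -/
theorem annihUp_conjTranspose_mul_annihDown (n : ℕ) :
    (annihUp n)ᴴ * annihDown n = spinRaise n := by
  ext i j
  simp only [annihUp, annihDown, spinRaise, mul_apply, conjTranspose_apply, of_apply]
  simp only [eq_comm (b := (i : ℕ)), apply_ite star, star_zero, ite_mul, zero_mul]
  rw [sum_ite_eq_val (i : ℕ)]
  have hj := j.is_lt
  by_cases h : (i : ℕ) + 1 = j
  · have hn : (0 : ℝ) ≤ (j : ℕ) := by positivity
    rw [dif_pos (by omega), if_pos h, if_pos h, Complex.star_def, Complex.conj_ofReal,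
      ← Complex.ofReal_mul, Real.sqrt_mul hn, mul_comm, ← h, Nat.cast_add, Nat.cast_one,
      add_sub_add_right_eq_sub]
  · simp [h]

theorem annihUp_mul_annihDown_conjTranspose (m : ℕ) :
    annihUp (m + 1) * (annihDown (m + 1))ᴴ = (spinRaise m)ᴴ := by
  ext i j
  simp only [annihUp, annihDown, spinRaise, mul_apply, conjTranspose_apply, of_apply, ite_mul,
    zero_mul]
  have hi := i.is_lt
  rw [sum_ite_eq_val (i : ℕ), dif_pos (by omega)]
  by_cases h : (j : ℕ) + 1 = i
  · have hn : (0 : ℝ) ≤ (i : ℕ) := by positivity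
    rw [if_pos h, if_pos h, Complex.star_def, Complex.conj_ofReal, Complex.conj_ofReal,
      ← Complex.ofReal_mul, Real.sqrt_mul hn, mul_comm]
    push_cast
    rfl
  · simp [h]

theorem spinRaise_mul_conjTranspose (n : ℕ) :
    spinRaise n * (spinRaise n)ᴴ =
      diagonal fun i : Fin (n + 1) => (((i : ℕ) : ℂ) + 1) * ((n : ℂ) - (i : ℕ)) := by
  ext i j
  simp only [spinRaise, mul_apply, conjTranspose_apply, of_apply, diagonal_apply, ite_mul, zero_mul]
  have hi := i.is_lt
  rw [sum_ite_eq_val ((i : ℕ) + 1)]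
  have hn : (0 : ℝ) ≤ (((i : ℕ) : ℝ) + 1) * ((n : ℝ) + 1 - (((i : ℕ) : ℝ) + 1)) := by
    have : ((i : ℕ) : ℝ) ≤ n := by exact_mod_cast Fin.is_le i
    exact mul_nonneg (by positivity) (by linarith)
  by_cases h : i = j
  · subst h
    by_cases h' : (i : ℕ) < n
    · simp only [h', dif_pos, add_lt_add_iff_right, if_true, Complex.star_def, Complex.conj_ofReal]
      push_cast
      rw [ofReal_sqrt_mul_self hn]
      push_cast
      ring
    · have : (i : ℕ) = n := by omega
      simp [this]
  · have h' : (j : ℕ) ≠ i := fun h' => h (Fin.ext h'.symm)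
    simp [h, h']

theorem conjTranspose_spinRaise_mul (n : ℕ) :
    (spinRaise n)ᴴ * spinRaise n =
      diagonal fun i : Fin (n + 1) => ((i : ℕ) : ℂ) * ((n : ℂ) + 1 - (i : ℕ)) := by
  ext i j
  simp only [spinRaise, mul_apply, conjTranspose_apply, of_apply, diagonal_apply]
  have hi := i.is_lt
  have hn : (0 : ℝ) ≤ ((i : ℕ) : ℝ) * ((n : ℝ) + 1 - ((i : ℕ) : ℝ)) := by
    have : ((i : ℕ) : ℝ) ≤ n := by exact_mod_cast Fin.is_le i
    exact mul_nonneg (by positivity) (by linarith)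
  by_cases h : i = j
  · subst h
    by_cases h' : (i : ℕ) = 0
    · rw [sum_eq_zero]
      · simp [h']
      · intro x _
        rw [if_neg (by omega)]
        simp
    · rw [Fintype.sum_eq_single ⟨i - 1, by omega⟩]
      · simp only [show (i : ℕ) - 1 + 1 = i by omega, if_true, Complex.star_def,
          Complex.conj_ofReal]
        rw [ofReal_sqrt_mul_self hn]
        push_cast
        ring
      · intro x hx
        rw [if_neg]
        · simp
        · intro h
          exact hx (Fin.ext (by simp; omega))
  · have h' : (i : ℕ) ≠ j := fun h' => h (Fin.ext h')
    rw [if_neg h, sum_eq_zero]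
    intro x _
    by_cases h1 : (x : ℕ) + 1 = i
    · rw [if_neg (show ¬ (x : ℕ) + 1 = j by omega), mul_zero]
    · rw [if_neg h1, star_zero, zero_mul]

theorem spinX_sq_add_spinY_sq (n : ℕ) : spinX n * spinX n + spinY n * spinY n =
    (1 / 2 : ℂ) • (spinRaise n * (spinRaise n)ᴴ + (spinRaise n)ᴴ * spinRaise n) := by
  have h : (1 / (2 * Complex.I)) * (1 / (2 * Complex.I)) = -(1 / 4 : ℂ) := by
    field_simp
    rw [Complex.I_sq]
    norm_num
  simp only [spinX, spinY, Matrix.smul_mul, Matrix.mul_smul, smul_smul, h]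
  simp only [Matrix.mul_add, Matrix.add_mul, Matrix.mul_sub, Matrix.sub_mul]
  module

theorem sum_spinVec_sq (n : ℕ) : ∑ a, spinVec n a * spinVec n a =
    ((n : ℂ) / 2 * ((n : ℂ) / 2 + 1)) • (1 : SpinOp n) := by
  simp only [Fin.sum_univ_three, spinVec, cons_val_zero, cons_val_one, Matrix.cons_val]
  rw [spinX_sq_add_spinY_sq, spinRaise_mul_conjTranspose, conjTranspose_spinRaise_mul, spinZ,
    diagonal_mul_diagonal, diagonal_add, ← diagonal_smul, diagonal_add, ← diagonal_one,
    ← diagonal_smul]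
  congr 1
  ext i
  simp only [Pi.smul_apply, smul_eq_mul]
  ring

theorem sum_spinVec_kronecker (n m : ℕ) : (2 : ℂ) • ∑ a, spinVec n a ⊗ₖ spinVec m a =
    spinRaise n ⊗ₖ (spinRaise m)ᴴ + (spinRaise n)ᴴ ⊗ₖ spinRaise m +
      (2 : ℂ) • (spinZ n ⊗ₖ spinZ m) := by
  have h : (1 / (2 * Complex.I)) * (1 / (2 * Complex.I)) = -(1 / 4 : ℂ) := by
    field_simp
    rw [Complex.I_sq]
    norm_num
  simp only [Fin.sum_univ_three, spinVec, cons_val_zero, cons_val_one, Matrix.cons_val, spinX, spinY,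
    smul_kronecker, kronecker_smul, smul_smul, h]
  simp only [add_kronecker, kronecker_add, sub_eq_add_neg, ← neg_one_smul ℂ (spinRaise _)ᴴ,
    smul_kronecker, kronecker_smul]
  module

/-- Since each single-spin Casimir is scalar, only the coupling `2 S_J · S_K` varies. Both the
hopping identity and rotation invariance are read off from this form. -/
theorem totalSpinSq_eq (n m : ℕ) : totalSpinSq n m =
    ((n : ℂ) / 2 * ((n : ℂ) / 2 + 1) + (m : ℂ) / 2 * ((m : ℂ) / 2 + 1)) • 1 +
      (2 : ℂ) • ∑ a, spinVec n a ⊗ₖ spinVec m a := by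
  have h : ∀ a, totalSpin n m a * totalSpin n m a = (spinVec n a * spinVec n a) ⊗ₖ (1 : SpinOp m) +
      (1 : SpinOp n) ⊗ₖ (spinVec m a * spinVec m a) + (2 : ℂ) • (spinVec n a ⊗ₖ spinVec m a) := by
    intro a
    simp only [totalSpin, Matrix.mul_add, Matrix.add_mul, ← mul_kronecker_mul, Matrix.mul_one,
      Matrix.one_mul]
    module
  have e1 : ∑ a, (spinVec n a * spinVec n a) ⊗ₖ (1 : SpinOp m) =
      (∑ a, spinVec n a * spinVec n a) ⊗ₖ (1 : SpinOp m) := by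
    simp only [Fin.sum_univ_three, add_kronecker]
  have e2 : ∑ a, (1 : SpinOp n) ⊗ₖ (spinVec m a * spinVec m a) =
      (1 : SpinOp n) ⊗ₖ (∑ a, spinVec m a * spinVec m a) := by
    simp only [Fin.sum_univ_three, kronecker_add]
  simp only [totalSpinSq, h, sum_add_distrib]
  rw [e1, e2, sum_spinVec_sq, sum_spinVec_sq, smul_kronecker, kronecker_smul, one_kronecker_one,
    ← smul_sum, add_smul]

/-- The Casimir minus `s (s + 1)` is a Gram matrix, with `s = (m - n) / 2` taken with its sign. For
`n ≤ m` this `s` is the minimal spin, so the minimal spin space is the kernel of `hopping`. -/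
theorem hopping_conjTranspose_mul_self (n m : ℕ) : totalSpinSq n m =
    (hopping n m)ᴴ * hopping n m +
      (((m : ℂ) / 2 - (n : ℂ) / 2) * ((m : ℂ) / 2 - (n : ℂ) / 2 + 1)) • 1 := by
  have h1 : (annihDown n)ᴴ * annihUp n = (spinRaise n)ᴴ := by
    rw [← annihUp_conjTranspose_mul_annihDown, conjTranspose_mul, conjTranspose_conjTranspose]
  have h2 : annihDown (m + 1) * (annihUp (m + 1))ᴴ = spinRaise m := by
    rw [← conjTranspose_conjTranspose (spinRaise m), ← annihUp_mul_annihDown_conjTranspose,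
      conjTranspose_mul, conjTranspose_conjTranspose]
  rw [totalSpinSq_eq, sum_spinVec_kronecker, hopping]
  simp only [conjTranspose_add, conjTranspose_kronecker, conjTranspose_conjTranspose,
    Matrix.mul_add, Matrix.add_mul, ← mul_kronecker_mul, annihUp_conjTranspose_mul_self,
    annihDown_conjTranspose_mul_self, annihUp_mul_conjTranspose_self,
    annihDown_mul_conjTranspose_self, annihUp_conjTranspose_mul_annihDown, h1, h2,
    annihUp_mul_annihDown_conjTranspose, spinZ, diagonal_kronecker_diagonal]
  have h3 : ∀ d d₁ d₂ : Fin (n + 1) × Fin (m + 1) → ℂ, ∀ c c' : ℂ,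
      (∀ x, c + 2 * d x = d₁ x + d₂ x + c') →
      c • (1 : Matrix (Fin (n + 1) × Fin (m + 1)) (Fin (n + 1) × Fin (m + 1)) ℂ) +
        (2 : ℂ) • diagonal d = diagonal d₁ + diagonal d₂ + c' • 1 := by
    intro d d₁ d₂ c c' h
    rw [← diagonal_one, ← diagonal_smul, ← diagonal_smul, ← diagonal_smul, diagonal_add,
      diagonal_add, diagonal_add]
    congr 1
    ext x
    simpa using h x
  have h4 := h3 _ _ _ ((n : ℂ) / 2 * ((n : ℂ) / 2 + 1) + (m : ℂ) / 2 * ((m : ℂ) / 2 + 1))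
    (((m : ℂ) / 2 - (n : ℂ) / 2) * ((m : ℂ) / 2 - (n : ℂ) / 2 + 1))
    (fun x : Fin (n + 1) × Fin (m + 1) =>
    show _ + 2 * (((n : ℂ) / 2 - (x.1 : ℕ)) * ((m : ℂ) / 2 - (x.2 : ℕ))) =
      ((n : ℂ) - (x.1 : ℕ)) * ((m : ℂ) + 1 - (x.2 : ℕ)) + (x.1 : ℕ) * (((x.2 : ℕ) : ℂ) + 1) + _
      by ring)
  rw [← sub_eq_zero] at h4 ⊢
  rw [← h4]
  abel

end Casimir

/-! ### The minimal spin subspace as the kernel of the hopping operator -/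

section MinimalSpin

/-- Extension by zero of a vector of `H_J ⊗ H_K`. -/
def extendZero {n m : ℕ} (v : Fin (n + 1) × Fin (m + 1) → ℂ) (a b : ℕ) : ℂ :=
  if h : a < n + 1 ∧ b < m + 1 then v (⟨a, h.1⟩, ⟨b, h.2⟩) else 0

theorem hopping_mulVec {n m : ℕ} (v : Fin (n + 1) × Fin (m + 1) → ℂ) (i : Fin n)
    (j : Fin (m + 2)) : (hopping n m *ᵥ v) (i, j) =
      ((√((n : ℝ) - (i : ℕ)) * √((m : ℝ) + 1 - (j : ℕ)) : ℝ) : ℂ) * extendZero v i j +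
      ((√(((i : ℕ) : ℝ) + 1) * √((j : ℕ) : ℝ) : ℝ) : ℂ) * extendZero v (i + 1) (j - 1) := by
  have hi := i.is_lt
  have hj := j.is_lt
  simp only [mulVec, dotProduct, Fintype.sum_prod_type, hopping, Matrix.add_apply, kroneckerMap_apply,
    add_mul, sum_add_distrib, conjTranspose_apply]
  congr 1
  · rw [Fintype.sum_eq_single ⟨i, by omega⟩]
    · have : ∀ b : Fin (m + 1), annihUp n i ⟨i, by omega⟩ * star (annihUp (m + 1) b j) *
          v (⟨i, by omega⟩, b) = if (j : ℕ) = b then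
            ((√((n : ℝ) - (i : ℕ)) * √((m : ℝ) + 1 - (j : ℕ)) : ℝ) : ℂ) *
              v (⟨i, by omega⟩, b) else 0 := by
        intro b
        by_cases h : (j : ℕ) = b
        · simp [annihUp, h]
        · simp [annihUp, h, Ne.symm h]
      rw [sum_congr rfl fun b _ => this b, sum_ite_eq_val (j : ℕ), extendZero]
      by_cases h : (j : ℕ) < m + 1
      · rw [dif_pos h, dif_pos ⟨by omega, h⟩]
      · rw [dif_neg h, dif_neg (by omega), mul_zero]
    · intro a ha
      have : (i : ℕ) ≠ a := fun h => ha (Fin.ext h.symm)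
      simp [annihUp, this]
  · rw [Fintype.sum_eq_single ⟨i + 1, by omega⟩]
    · by_cases h0 : (j : ℕ) = 0
      · rw [sum_eq_zero]
        · simp [h0]
        · intro b _
          simp [annihDown, h0]
      · rw [Fintype.sum_eq_single ⟨j - 1, by omega⟩]
        · rw [extendZero, dif_pos ⟨by omega, by omega⟩]
          simp [annihDown, show (j : ℕ) - 1 + 1 = j by omega]
        · intro b hb
          have : (b : ℕ) + 1 ≠ j := fun h => hb (Fin.ext (by simp; omega))
          simp [annihDown, this]
    · intro a ha
      have : (i : ℕ) + 1 ≠ a := fun h => ha (Fin.ext h.symm)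
      simp [annihDown, this]

theorem monomialNorm_succ {m j : ℕ} (h : j < m) :
    monomialNorm m (j + 1) * √((m : ℝ) - j) = monomialNorm m j * √((j : ℝ) + 1) := by
  have h1 : (0 : ℝ) ≤ (m : ℝ) - j := by rw [sub_nonneg]; exact_mod_cast h.le
  unfold monomialNorm
  rw [← Real.sqrt_mul (by positivity), ← Real.sqrt_mul (by positivity)]
  congr 1
  rw [Nat.factorial_succ, show m - j = m - (j + 1) + 1 by omega, Nat.factorial_succ]
  push_cast [Nat.cast_sub (show j + 1 ≤ m by omega)]
  ring

/-- Up to the alternating sign, this is the two-term recursion that the kernel of `hopping` imposes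
along an antidiagonal. -/
theorem fusionCoeff_succ {n k t q : ℕ} (ht : t < n) (hq : q ≤ k) :
    √((t : ℝ) + 1) * √(((n + k : ℕ) : ℝ) - ((t + q : ℕ) : ℝ)) *
        fusionCoeff n k (t + q + 1) (t + 1) q =
      √((n : ℝ) - t) * √(((t + q : ℕ) : ℝ) + 1) * fusionCoeff n k (t + q) t q := by
  rw [fusionCoeff_of_eq n k (show t + q + 1 = t + 1 + q by omega), fusionCoeff_of_eq n k rfl]
  have h1 := monomialNorm_succ ht
  have h2 := monomialNorm_succ (show t + q < n + k by omega)
  have := monomialNorm_ne_zero n t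
  have := monomialNorm_ne_zero n (t + 1)
  have := monomialNorm_ne_zero k q
  field_simp
  linear_combination (√((t : ℝ) + 1) * monomialNorm n t) * h2 -
    (√(((t + q : ℕ) : ℝ) + 1) * monomialNorm (n + k) (t + q)) * h1

/-- Columns: unnormalized orthogonal basis of the minimal spin subspace of `H_J ⊗ H_K`. -/
def minSpinFrame (n k m : ℕ) : Matrix (Fin (n + 1) × Fin (m + 1)) (Fin (k + 1)) ℂ :=
  Matrix.of fun x q => (-1) ^ (x.1 : ℕ) * (fusionCoeff n k x.2 (n - x.1) q : ℂ)

theorem minSpinFrame_conjTranspose_mul_self (n k : ℕ) :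
    (minSpinFrame n k (n + k))ᴴ * minSpinFrame n k (n + k) =
      (((n + k + 1).choose (k + 1) : ℝ) : ℂ) • 1 := by
  ext q q'
  simp only [minSpinFrame, mul_apply, conjTranspose_apply, of_apply, Fintype.sum_prod_type]
  have h1 := sum_fusionCoeff_col (n := n) (Fin.is_le q) (Fin.is_le q')
  rw [sum_congr rfl fun s _ => (sum_range_reflect (fun i => fusionCoeff n k s i q *
    fusionCoeff n k s i q') (n + 1)).symm] at h1
  simp only [← Fin.sum_univ_eq_sum_range] at h1
  rw [Fin.sum_univ_eq_sum_range (fun s => ∑ i : Fin (n + 1),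
    fusionCoeff n k s (n + 1 - 1 - i) q * fusionCoeff n k s (n + 1 - 1 - i) q')] at h1
  rw [sum_comm]
  trans (((∑ s : Fin (n + k + 1), ∑ i : Fin (n + 1),
    fusionCoeff n k s (n - i) q * fusionCoeff n k s (n - i) q' : ℝ)) : ℂ)
  · push_cast
    refine sum_congr rfl fun s _ => sum_congr rfl fun i _ => ?_
    rw [star_mul', star_pow, Complex.star_def, Complex.conj_ofReal, map_neg,
      map_one]
    have : ((-1 : ℂ) ^ (i : ℕ)) * ((-1 : ℂ) ^ (i : ℕ)) = 1 := by
      rw [← mul_pow]; simp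
    linear_combination ((fusionCoeff n k s (n - i) q : ℂ) * (fusionCoeff n k s (n - i) q' : ℂ)) *
      this
  · rw [Fin.sum_univ_eq_sum_range (fun s => ∑ i : Fin (n + 1),
      fusionCoeff n k s (n - i) q * fusionCoeff n k s (n - i) q')]
    simp only [Nat.add_sub_cancel] at h1
    rw [h1]
    simp only [Matrix.smul_apply, Matrix.one_apply, Fin.ext_iff]
    split_ifs <;> simp

theorem hopping_mul_minSpinFrame (n k : ℕ) :
    hopping n (n + k) * minSpinFrame n k (n + k) = 0 := by
  ext ⟨i, j⟩ q
  have hi := i.is_lt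
  have hj := j.is_lt
  have hq := q.is_lt
  have h1 : (hopping n (n + k) * minSpinFrame n k (n + k)) (i, j) q =
      (hopping n (n + k) *ᵥ (fun x => minSpinFrame n k (n + k) x q)) (i, j) := rfl
  rw [h1, hopping_mulVec]
  have h2 : ∀ a b : ℕ, extendZero (fun x => minSpinFrame n k (n + k) x q) a b =
      if a < n + 1 ∧ b < n + k + 1 then (-1) ^ a * (fusionCoeff n k b (n - a) q : ℂ) else 0 := by
    intro a b
    unfold extendZero
    split_ifs <;> rfl
  rw [h2, h2, if_pos (show (i : ℕ) + 1 < n + 1 ∧ (j : ℕ) - 1 < n + k + 1 by omega)]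
  by_cases h : (j : ℕ) = n - i + q
  · rw [if_pos (by omega), show (i : ℕ) = n - ((n - (i + 1)) + 1) by omega]
    generalize ht : n - ((i : ℕ) + 1) = t
    have htn : t < n := by omega
    have h3 := fusionCoeff_succ htn (Fin.is_le q)
    rw [show n - (n - (t + 1)) = t + 1 by omega, show n - (n - (t + 1) + 1) = t by omega,
      show (j : ℕ) - 1 = t + q by omega, show (j : ℕ) = t + q + 1 by omega]
    have e1 : (n : ℝ) - ((n - (t + 1) : ℕ) : ℝ) = t + 1 := by
      rw [Nat.cast_sub (by omega)]; push_cast; ring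
    have e2 : ((n - (t + 1) : ℕ) : ℝ) + 1 = n - t := by
      rw [Nat.cast_sub (by omega)]; push_cast; ring
    have e3 : ((n + k : ℕ) : ℝ) + 1 - ((t + q + 1 : ℕ) : ℝ) = ((n + k : ℕ) : ℝ) - ((t + q : ℕ) : ℝ) := by
      push_cast; ring
    rw [e1, e2, e3, Nat.cast_add_one]
    have h4 := congrArg (fun x : ℝ => (x : ℂ)) h3
    simp only [Complex.ofReal_mul] at h4 ⊢
    rw [pow_succ, Matrix.zero_apply]
    linear_combination ((-1 : ℂ) ^ (n - (t + 1))) * h4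
  · rw [fusionCoeff_of_ne n k (show (j : ℕ) ≠ n - i + q from h)]
    by_cases h0 : (j : ℕ) = 0
    · simp [h0]
    · rw [fusionCoeff_of_ne n k (show (j : ℕ) - 1 ≠ n - (i + 1) + q by omega)]
      simp

theorem eq_minSpinFrame_mulVec_of_hopping_mulVec_eq_zero {n k : ℕ}
    (v : Fin (n + 1) × Fin (n + k + 1) → ℂ) (hv : hopping n (n + k) *ᵥ v = 0) :
    ∃ y, v = minSpinFrame n k (n + k) *ᵥ y := by
  have hE : ∀ i j : ℕ, i < n → j < n + k + 2 →
      ((√((n : ℝ) - i) * √(((n + k : ℕ) : ℝ) + 1 - j) : ℝ) : ℂ) * extendZero v i j +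
      ((√((i : ℝ) + 1) * √(j : ℝ) : ℝ) : ℂ) * extendZero v (i + 1) (j - 1) = 0 := by
    intro i j hi hj
    have := hopping_mulVec v ⟨i, hi⟩ ⟨j, hj⟩
    rw [hv] at this
    exact this.symm
  have hpos : ∀ i j : ℕ, i < n → j < n + k + 1 →
      ((√((n : ℝ) - i) * √(((n + k : ℕ) : ℝ) + 1 - j) : ℝ) : ℂ) ≠ 0 := by
    intro i j hi hj
    have h1 : (0 : ℝ) < n - i := by rw [sub_pos]; exact_mod_cast hi
    have h2 : (0 : ℝ) < ((n + k : ℕ) : ℝ) + 1 - j := by rw [sub_pos]; exact_mod_cast hj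
    exact_mod_cast (mul_pos (Real.sqrt_pos.mpr h1) (Real.sqrt_pos.mpr h2)).ne'
  have hpos' : ∀ i j : ℕ, 0 < j → ((√((i : ℝ) + 1) * √(j : ℝ) : ℝ) : ℂ) ≠ 0 := by
    intro i j hj
    have h2 : (0 : ℝ) < j := by exact_mod_cast hj
    have h1 : (0 : ℝ) < (i : ℝ) + 1 := by positivity
    exact_mod_cast (mul_pos (Real.sqrt_pos.mpr h1) (Real.sqrt_pos.mpr h2)).ne'
  -- At `j = 0` the second coefficient is `√0`, which forces `v (i, 0) = 0`; the zero then spreads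
  -- along the antidiagonal.
  have hlow : ∀ j i : ℕ, i + j < n → extendZero v i j = 0 := by
    intro j
    induction j with
    | zero =>
      intro i hi
      have h := hE i 0 (by omega) (by omega)
      simp only [Nat.cast_zero, Real.sqrt_zero, mul_zero, Complex.ofReal_zero, zero_mul,
        add_zero] at h
      exact (mul_eq_zero.mp h).resolve_left (by simpa using hpos i 0 (by omega) (by omega))
    | succ j ih =>
      intro i hi
      have h := hE i (j + 1) (by omega) (by omega)
      rw [Nat.add_sub_cancel, ih (i + 1) (by omega), mul_zero, add_zero] at h
      exact (mul_eq_zero.mp h).resolve_left (hpos i (j + 1) (by omega) (by omega))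
  -- Here the start is the equation at `j = n + k + 1`, where the first entry lies outside the index
  -- range and is zero by extension.
  have hhigh : ∀ t i : ℕ, t ≤ n + k → t < i → i ≤ n → extendZero v i (n + k - t) = 0 := by
    intro t
    induction t with
    | zero =>
      intro i _ h1 h2
      have h := hE (i - 1) (n + k + 1) (by omega) (by omega)
      have h0 : extendZero v (i - 1) (n + k + 1) = 0 := dif_neg (by omega)
      rw [h0, mul_zero, zero_add, show i - 1 + 1 = i by omega, Nat.add_sub_cancel] at h
      exact (mul_eq_zero.mp h).resolve_left (hpos' (i - 1) (n + k + 1) (by omega))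
    | succ t ih =>
      intro i h0 h1 h2
      have h := hE (i - 1) (n + k - t) (by omega) (by omega)
      rw [ih (i - 1) (by omega) (by omega) (by omega), mul_zero, zero_add,
        show i - 1 + 1 = i by omega, show n + k - t - 1 = n + k - (t + 1) by omega] at h
      exact (mul_eq_zero.mp h).resolve_left (hpos' (i - 1) (n + k - t) (by omega))
  -- The coordinates are read off in the row `i = n`, where column `q` of the frame has its only
  -- nonzero entry at `j = q`.
  set y : ℕ → ℂ := fun q => (-1) ^ n * extendZero v n q / (fusionCoeff n k q 0 q : ℂ) with hy
  have hmid : ∀ q t : ℕ, q ≤ k → t ≤ n → extendZero v (n - t) (t + q) =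
      (-1) ^ (n - t) * (fusionCoeff n k (t + q) t q : ℂ) * y q := by
    intro q t hq
    have hne : fusionCoeff n k q 0 q ≠ 0 := by
      rw [fusionCoeff_of_eq n k (show q = 0 + q by omega)]
      exact div_ne_zero (monomialNorm_ne_zero _ _)
        (mul_ne_zero (monomialNorm_ne_zero _ _) (monomialNorm_ne_zero _ _))
    induction t with
    | zero =>
      intro _
      have hne' : (fusionCoeff n k q 0 q : ℂ) ≠ 0 := by exact_mod_cast hne
      simp only [hy, Nat.sub_zero, zero_add]
      have : ((-1 : ℂ) ^ n) * ((-1 : ℂ) ^ n) = 1 := by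
        rw [← mul_pow]; simp
      field_simp
      linear_combination -extendZero v n q * this
    | succ t ih =>
      intro ht
      have h := hE (n - (t + 1)) (t + 1 + q) (by omega) (by omega)
      rw [show n - (t + 1) + 1 = n - t by omega, show t + 1 + q - 1 = t + q by omega,
        ih (by omega)] at h
      have h3 := congrArg (fun x : ℝ => (x : ℂ)) (fusionCoeff_succ (show t < n by omega) hq)
      have e1 : (n : ℝ) - ((n - (t + 1) : ℕ) : ℝ) = t + 1 := by
        rw [Nat.cast_sub (by omega)]; push_cast; ring
      have e2 : ((n - (t + 1) : ℕ) : ℝ) + 1 = n - t := by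
        rw [Nat.cast_sub (by omega)]; push_cast; ring
      have e3 : ((n + k : ℕ) : ℝ) + 1 - ((t + 1 + q : ℕ) : ℝ) =
          ((n + k : ℕ) : ℝ) - ((t + q : ℕ) : ℝ) := by
        push_cast; ring
      have e4 : ((t + 1 + q : ℕ) : ℝ) = ((t + q : ℕ) : ℝ) + 1 := by push_cast; ring
      have hp := hpos (n - (t + 1)) (t + 1 + q) (by omega) (by omega)
      rw [e1, e3] at hp
      rw [e1, e2, e3, e4] at h
      apply mul_left_cancel₀ hp
      rw [show t + 1 + q = t + q + 1 by omega] at h ⊢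
      simp only [Complex.ofReal_mul] at h h3 ⊢
      rw [show n - t = n - (t + 1) + 1 by omega, pow_succ] at h
      linear_combination h - ((-1) ^ (n - (t + 1)) * y q) * h3
  refine ⟨fun q => y q, ?_⟩
  ext ⟨i, j⟩
  have hi := i.is_lt
  have hj := j.is_lt
  have hvij : v (i, j) = extendZero v i j := by
    rw [extendZero, dif_pos ⟨hi, hj⟩]
  rw [hvij]
  simp only [mulVec, dotProduct, minSpinFrame, of_apply]
  by_cases h : n ≤ i + j ∧ (i : ℕ) + j ≤ n + k
  · have h1 := hmid (i + j - n) (n - i) (by omega) (by omega)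
    rw [show n - (n - (i : ℕ)) = i by omega, show n - (i : ℕ) + (i + j - n) = j by omega] at h1
    rw [h1, Fintype.sum_eq_single ⟨i + j - n, by omega⟩]
    intro q hq
    have : (j : ℕ) ≠ n - i + q := fun h' => hq (Fin.ext (by simp; omega))
    rw [fusionCoeff_of_ne n k this]
    simp
  · rw [sum_eq_zero]
    · by_cases h' : (i : ℕ) + j < n
      · exact hlow j i h'
      · have := hhigh (n + k - j) i (by omega) (by omega) (by omega)
        rwa [show n + k - (n + k - (j : ℕ)) = j by omega] at this
    · intro q _
      rw [fusionCoeff_of_ne n k (show (j : ℕ) ≠ n - i + q by have := q.is_lt; omega)]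
      simp

theorem minSpin_add (n k : ℕ) : minSpin n (n + k) = (k : ℝ) / 2 := by
  rw [minSpin, Nat.cast_add, abs_of_nonneg]
  · ring
  · have : (0 : ℝ) ≤ (k : ℝ) := by positivity
    linarith

theorem isEigenProj_minSpinFrame (n k : ℕ) :
    IsEigenProj (totalSpinSq n (n + k))
      ((minSpin n (n + k) * (minSpin n (n + k) + 1) : ℝ) : ℂ)
      ((((n + k + 1).choose (k + 1) : ℝ) : ℂ)⁻¹ •
        (minSpinFrame n k (n + k) * (minSpinFrame n k (n + k))ᴴ)) := by
  refine isEigenProj_of_frame ?_ ?_ (minSpinFrame_conjTranspose_mul_self n k)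
    (hopping_mul_minSpinFrame n k) eq_minSpinFrame_mulVec_of_hopping_mulVec_eq_zero
  · rw [hopping_conjTranspose_mul_self, minSpin_add]
    congr 2
    push_cast
    ring
  · exact_mod_cast (Nat.choose_pos (by omega)).ne'

theorem minSpinProj_add (n k : ℕ) : minSpinProj n (n + k) =
    (((n + k + 1).choose (k + 1) : ℝ) : ℂ)⁻¹ •
      (minSpinFrame n k (n + k) * (minSpinFrame n k (n + k))ᴴ) :=
  (isEigenProj_minSpinFrame n k).eigenProj_eq

theorem totalSpinSq_submatrix_swap (n m : ℕ) :
    (totalSpinSq n m).submatrix (Equiv.prodComm _ _) (Equiv.prodComm _ _) = totalSpinSq m n := by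
  have h : ∀ a, (totalSpin n m a).submatrix (Equiv.prodComm _ _) (Equiv.prodComm _ _) =
      totalSpin m n a := by
    intro a
    ext ⟨i, j⟩ ⟨i', j'⟩
    simp only [totalSpin, submatrix_apply, Matrix.add_apply, kroneckerMap_apply, Equiv.prodComm_apply,
      Prod.swap]
    ring
  simp only [totalSpinSq, Fin.sum_univ_three, submatrix_add, ← submatrix_mul_equiv _ _ _
    (Equiv.prodComm (Fin (m + 1)) (Fin (n + 1))), Pi.add_apply, h]

/-- Swapping the tensor factors preserves both the Casimir and the minimal spin, so the case `n > m`
needs no second kernel computation. -/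
theorem minSpinProj_add_left (m k : ℕ) : minSpinProj (m + k) m =
    (minSpinProj m (m + k)).submatrix (Equiv.prodComm _ _) (Equiv.prodComm _ _) := by
  have h := (isEigenProj_eigenProj (totalSpinSq m (m + k))
    ((minSpin m (m + k) * (minSpin m (m + k) + 1) : ℝ) : ℂ)).submatrix
    (Equiv.prodComm (Fin (m + k + 1)) (Fin (m + 1)))
  rw [totalSpinSq_submatrix_swap] at h
  rw [minSpinProj, show minSpin (m + k) m = minSpin m (m + k) from abs_sub_comm _ _,
    h.eigenProj_eq]
  rfl

end MinimalSpin

/-! ### Completely positive maps with real Kraus operators -/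

section Kraus

variable {α ι κ : Type*} [Fintype α] [Fintype ι] [Fintype κ]

/-- The completely positive map with real Kraus operators `Z q`. -/
def krausMap (Z : α → κ → ι → ℝ) (ρ : Matrix ι ι ℂ) : Matrix κ κ ℂ :=
  Matrix.of fun s s' => ∑ q, ∑ i, ∑ i', (Z q s i : ℂ) * (Z q s' i' : ℂ) * ρ i i'

theorem krausMap_posSemidef (Z : α → κ → ι → ℝ) {ρ : Matrix ι ι ℂ} (h : ρ.PosSemidef) :
    (krausMap Z ρ).PosSemidef := by
  have : krausMap Z ρ = ∑ q, (Matrix.of fun s i => (Z q s i : ℂ)) * ρ *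
      (Matrix.of fun s i => (Z q s i : ℂ))ᴴ := by
    ext s s'
    simp only [krausMap, of_apply, Matrix.sum_apply, mul_apply, conjTranspose_apply, sum_mul,
      Complex.star_def, Complex.conj_ofReal]
    refine sum_congr rfl fun q _ => ?_
    rw [sum_comm]
    refine sum_congr rfl fun i _ => sum_congr rfl fun i' _ => ?_
    ring
  rw [this]
  exact posSemidef_sum _ fun q _ => h.mul_mul_conjTranspose_same _

theorem krausMap_trace [DecidableEq ι] {Z : α → κ → ι → ℝ} {N : ℝ}
    (hZ : ∀ i i', ∑ q, ∑ s, Z q s i * Z q s i' = if i = i' then N else 0) (ρ : Matrix ι ι ℂ) :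
    (krausMap Z ρ).trace = N * ρ.trace := by
  calc (krausMap Z ρ).trace = ∑ i, ∑ i', ((∑ q, ∑ s, Z q s i * Z q s i' : ℝ) : ℂ) * ρ i i' := by
        push_cast
        simp only [trace, diag_apply, krausMap, of_apply, sum_mul]
        calc _ = ∑ q, ∑ s, ∑ i, ∑ i', _ := sum_comm
          _ = ∑ q, ∑ i, ∑ s, ∑ i', _ := sum_congr rfl fun q _ => sum_comm
          _ = ∑ i, ∑ q, ∑ s, ∑ i', _ := sum_comm
          _ = ∑ i, ∑ q, ∑ i', ∑ s, _ :=
            sum_congr rfl fun i _ => sum_congr rfl fun q _ => sum_comm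
          _ = ∑ i, ∑ i', ∑ q, ∑ s, _ := sum_congr rfl fun i _ => sum_comm
    _ = _ := by
        rw [trace, mul_sum]
        refine sum_congr rfl fun i _ => ?_
        rw [Fintype.sum_eq_single i]
        · rw [hZ, if_pos rfl, diag_apply]
        · intro i' hi'
          rw [hZ, if_neg hi'.symm, Complex.ofReal_zero, zero_mul]

end Kraus

/-! ### The channel as cloning or partial trace, and its value at a coherent state -/

section Channel

theorem cloning_eq_krausMap (n k m : ℕ) (ρ : SpinOp n) : cloning n k m ρ =
    krausMap (fun (q : Fin (k + 1)) (s : Fin (m + 1)) (i : Fin (n + 1)) =>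
      fusionCoeff n k s i q) ρ :=
  rfl

theorem trace_cloning (n k : ℕ) (ρ : SpinOp n) :
    (cloning n k (n + k) ρ).trace = ((n + k + 1).choose (n + 1) : ℝ) * ρ.trace := by
  rw [cloning_eq_krausMap]
  refine krausMap_trace (fun i i' => ?_) ρ
  have h := sum_fusionCoeff_col (n := k) (Fin.is_le i) (Fin.is_le i')
  simp only [← Fin.sum_univ_eq_sum_range] at h
  rw [Fin.sum_univ_eq_sum_range (fun s => ∑ q : Fin (k + 1),
    fusionCoeff k n s q i * fusionCoeff k n s q i'), add_comm k n] at h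
  rw [sum_comm, Fin.sum_univ_eq_sum_range (fun s => ∑ q : Fin (k + 1),
    fusionCoeff n k s i q * fusionCoeff n k s i' q)]
  simp only [fusionCoeff_comm k n] at h
  rw [h]
  simp only [Fin.ext_iff]

/-- The partial trace `ρ ↦ Tr_{n - m} (W* ρ W)` from degree `n = m + k` to degree `m`. -/
def reduction (m k : ℕ) (ρ : SpinOp (m + k)) : SpinOp m :=
  krausMap (fun (q : Fin (k + 1)) (j : Fin (m + 1)) (i : Fin (m + k + 1)) =>
    fusionCoeff m k i j q) ρ

theorem trace_reduction (m k : ℕ) (ρ : SpinOp (m + k)) :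
    (reduction m k ρ).trace = ((m + k).choose m : ℝ) * ρ.trace := by
  refine krausMap_trace (fun i i' => ?_) ρ
  have h := sum_fusionCoeff_row (i' := i') (show m ≤ m + k by omega) (Fin.is_le i)
  rw [Nat.add_sub_cancel_left] at h
  simp only [← Fin.sum_univ_eq_sum_range] at h
  rw [sum_comm, h]
  simp only [Fin.ext_iff]

/-- Time reversal composed with the adjoint: `ρ ↦ Y ρᵀ Y*` with `Y|M⟩ = ±|-M⟩`. -/
def timeReversal (n : ℕ) (ρ : SpinOp n) : SpinOp n :=
  Matrix.of fun i i' => (-1) ^ (n - (i : ℕ)) * (-1) ^ (n - (i' : ℕ)) * ρ i'.rev i.rev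

theorem neg_one_pow_mul_self (a : ℕ) : ((-1 : ℂ) ^ a) * (-1) ^ a = 1 := by
  rw [← mul_pow]; simp

theorem timeReversal_trace (n : ℕ) (ρ : SpinOp n) : (timeReversal n ρ).trace = ρ.trace := by
  simp only [timeReversal, trace, diag_apply, of_apply, neg_one_pow_mul_self, one_mul]
  exact Equiv.sum_comp Fin.revPerm fun i => ρ i i

theorem timeReversal_posSemidef {n : ℕ} {ρ : SpinOp n} (h : ρ.PosSemidef) :
    (timeReversal n ρ).PosSemidef := by
  have h1 : timeReversal n ρ = (diagonal fun i : Fin (n + 1) => (-1 : ℂ) ^ (n - (i : ℕ))) *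
      ρᵀ.submatrix Fin.rev Fin.rev *
      (diagonal fun i : Fin (n + 1) => (-1 : ℂ) ^ (n - (i : ℕ)))ᴴ := by
    ext i i'
    simp only [timeReversal, of_apply, diagonal_conjTranspose, mul_diagonal, diagonal_mul,
      submatrix_apply, transpose_apply, Pi.star_apply, star_pow, Complex.star_def, map_neg, map_one]
    ring
  rw [h1]
  exact (h.transpose.submatrix Fin.rev).mul_mul_conjTranspose_same _

theorem timeReversal_single (n : ℕ) :
    timeReversal n (Matrix.single (Fin.last n) (Fin.last n) 1) = Matrix.single 0 0 1 := by
  ext i i'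
  simp only [timeReversal, of_apply, single_apply]
  have h : ∀ j : Fin (n + 1), Fin.last n = j.rev ↔ 0 = j := by
    intro j
    rw [← Fin.rev_zero, Fin.rev_inj]
  simp only [h]
  by_cases h1 : 0 = i
  · by_cases h2 : 0 = i'
    · subst h1
      subst h2
      simp [neg_one_pow_mul_self]
    · simp [h2]
  · simp [h1]

theorem partialTraceLeft_mul_kronecker_one {n m : ℕ}
    (P : Matrix (Fin (n + 1) × Fin (m + 1)) (Fin (n + 1) × Fin (m + 1)) ℂ) (ρ : SpinOp n)
    (a b : Fin (m + 1)) : partialTraceLeft (P * (ρ ⊗ₖ (1 : SpinOp m))) a b =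
      ∑ i, ∑ i', P (i, a) (i', b) * ρ i' i := by
  simp only [partialTraceLeft, of_apply, mul_apply, Fintype.sum_prod_type, kroneckerMap_apply]
  refine sum_congr rfl fun i _ => sum_congr rfl fun i' _ => ?_
  rw [Fintype.sum_eq_single b]
  · simp
  · intro b' hb'
    simp [hb']

theorem minSpinFrame_mul_conjTranspose_apply (n k m : ℕ) (x y : Fin (n + 1) × Fin (m + 1)) :
    (minSpinFrame n k m * (minSpinFrame n k m)ᴴ) x y = ∑ q : Fin (k + 1),
      (-1) ^ (x.1 : ℕ) * (-1) ^ (y.1 : ℕ) * ((fusionCoeff n k x.2 (n - x.1) q : ℂ) *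
        (fusionCoeff n k y.2 (n - y.1) q : ℂ)) := by
  simp only [minSpinFrame, mul_apply, conjTranspose_apply, of_apply, star_mul', star_pow,
    Complex.star_def, Complex.conj_ofReal, map_neg, map_one]
  refine sum_congr rfl fun q _ => ?_
  ring

theorem choose_const_up (n k : ℕ) : (((n : ℝ) + 1) / ((k : ℝ) + 1)) *
    ((n + k + 1).choose (k + 1) : ℝ)⁻¹ = ((n + k + 1).choose (n + 1) : ℝ)⁻¹ := by
  have h1 : (n + k + 1).choose (k + 1) * (k + 1) = (n + k + 1).choose (n + 1) * (n + 1) := by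
    rw [Nat.choose_succ_right_eq, show n + k + 1 - k = n + 1 by omega,
      ← Nat.choose_symm (show k ≤ n + k + 1 by omega), show n + k + 1 - k = n + 1 by omega]
  have h2 : ((n + k + 1).choose (k + 1) : ℝ) ≠ 0 := by
    exact_mod_cast (Nat.choose_pos (by omega)).ne'
  have h3 : ((n + k + 1).choose (n + 1) : ℝ) ≠ 0 := by
    exact_mod_cast (Nat.choose_pos (by omega)).ne'
  have h1' : ((n + k + 1).choose (k + 1) : ℝ) * (k + 1) =
    (n + k + 1).choose (n + 1) * (n + 1) := by exact_mod_cast h1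
  field_simp
  linear_combination -h1'

theorem choose_const_down (m k : ℕ) : (((m + k : ℕ) : ℝ) + 1) / ((k : ℝ) + 1) *
    ((m + k + 1).choose (k + 1) : ℝ)⁻¹ = ((m + k).choose m : ℝ)⁻¹ := by
  have h1 : (m + k + 1) * (m + k).choose m = (m + k + 1).choose (k + 1) * (k + 1) := by
    rw [← Nat.add_one_mul_choose_eq, ← Nat.choose_symm (show m ≤ m + k by omega),
      Nat.add_sub_cancel_left]
  have h2 : ((m + k + 1).choose (k + 1) : ℝ) ≠ 0 := by
    exact_mod_cast (Nat.choose_pos (by omega)).ne'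
  have h3 : ((m + k).choose m : ℝ) ≠ 0 := by
    exact_mod_cast (Nat.choose_pos (by omega)).ne'
  have h1' : ((m : ℝ) + k + 1) * (m + k).choose m =
    (m + k + 1).choose (k + 1) * (k + 1) := by exact_mod_cast h1
  push_cast
  field_simp
  linear_combination h1'

/-- In `P_-` the first factor enters through `(-1)^i` and the reversed index `n - i`, and the trace
pairs it with the transpose of `ρ`. Reversing both indices collects these into `timeReversal`. -/
theorem channel_add (n k : ℕ) (ρ : SpinOp n) : channel n (n + k) ρ =
    ((((n + k + 1).choose (n + 1) : ℝ)⁻¹ : ℝ) : ℂ) • cloning n k (n + k) (timeReversal n ρ) := by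
  ext a b
  rw [channel, Matrix.smul_apply, Matrix.smul_apply, partialTraceLeft_mul_kronecker_one,
    minSpin_add, show 2 * ((k : ℝ) / 2) + 1 = k + 1 by ring, ← choose_const_up,
    Complex.ofReal_mul, smul_eq_mul, smul_eq_mul, mul_assoc]
  congr 1
  rw [minSpinProj_add]
  simp only [Matrix.smul_apply, smul_eq_mul, mul_assoc, ← mul_sum, Complex.ofReal_inv]
  congr 1
  simp only [minSpinFrame_mul_conjTranspose_apply, cloning, timeReversal, of_apply, sum_mul]
  calc _ = ∑ i, ∑ q : Fin (k + 1), ∑ i' : Fin (n + 1), _ := sum_congr rfl fun i _ => sum_comm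
    _ = ∑ q : Fin (k + 1), ∑ i : Fin (n + 1), ∑ i' : Fin (n + 1), _ := sum_comm
    _ = _ := ?_
  refine sum_congr rfl fun q _ => ?_
  rw [← Equiv.sum_comp Fin.revPerm]
  refine sum_congr rfl fun i _ => ?_
  rw [← Equiv.sum_comp Fin.revPerm]
  refine sum_congr rfl fun i' _ => ?_
  have hr : ∀ i : Fin (n + 1), n - (i.rev : ℕ) = i ∧ (i.rev : ℕ) = n - i := by
    intro i
    have := i.is_lt
    rw [Fin.val_rev]
    omega
  simp only [Fin.revPerm_apply, (hr i).1, (hr i').1]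
  rw [(hr i).2, (hr i').2]
  ring

theorem channel_add_left (m k : ℕ) (ρ : SpinOp (m + k)) : channel (m + k) m ρ =
    ((((m + k).choose m : ℝ)⁻¹ : ℝ) : ℂ) • timeReversal m (reduction m k ρ) := by
  ext a b
  rw [channel, Matrix.smul_apply, Matrix.smul_apply, partialTraceLeft_mul_kronecker_one,
    show minSpin (m + k) m = minSpin m (m + k) from abs_sub_comm _ _,
    minSpin_add, show 2 * ((k : ℝ) / 2) + 1 = k + 1 by ring, ← choose_const_down,
    Complex.ofReal_mul, smul_eq_mul, smul_eq_mul, mul_assoc]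
  congr 1
  rw [minSpinProj_add_left, minSpinProj_add]
  simp only [submatrix_apply, Equiv.prodComm_apply, Prod.swap_prod_mk, Matrix.smul_apply,
    smul_eq_mul, mul_assoc, ← mul_sum, Complex.ofReal_inv]
  congr 1
  simp only [minSpinFrame_mul_conjTranspose_apply, reduction, krausMap, timeReversal, of_apply,
    sum_mul, mul_sum]
  calc _ = ∑ i, ∑ q : Fin (k + 1), ∑ i' : Fin (m + k + 1), _ := sum_congr rfl fun i _ => sum_comm
    _ = ∑ q : Fin (k + 1), ∑ i : Fin (m + k + 1), ∑ i' : Fin (m + k + 1), _ := sum_comm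
    _ = ∑ q : Fin (k + 1), ∑ i' : Fin (m + k + 1), ∑ i : Fin (m + k + 1), _ :=
      sum_congr rfl fun q _ => sum_comm
    _ = _ := ?_
  refine sum_congr rfl fun q _ => sum_congr rfl fun i' _ => sum_congr rfl fun i _ => ?_
  have hr : ∀ j : Fin (m + 1), (j.rev : ℕ) = m - j := by
    intro i
    have := i.is_lt
    rw [Fin.val_rev]
    omega
  have hs : ∀ j : Fin (m + 1), (-1 : ℂ) ^ (m - (j : ℕ)) = (-1) ^ m * (-1) ^ (j : ℕ) := by
    intro j
    have h1 : (-1 : ℂ) ^ m = (-1) ^ (m - (j : ℕ)) * (-1) ^ (j : ℕ) := by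
      rw [← pow_add, Nat.sub_add_cancel (Fin.is_le j)]
    rw [h1, mul_assoc, neg_one_pow_mul_self, mul_one]
  rw [hr, hr, hs, hs]
  -- The signs `(-1)^(m-a)` and `(-1)^a` differ by `(-1)^m`, which enters twice.
  linear_combination -((-1 : ℂ) ^ (a : ℕ) * (-1) ^ (b : ℕ) *
    (fusionCoeff m k i' (m - b) q : ℂ) * (fusionCoeff m k i (m - a) q : ℂ) * ρ i' i) *
    neg_one_pow_mul_self m

theorem trace_channel (n m : ℕ) (ρ : SpinOp n) : (channel n m ρ).trace = ρ.trace := by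
  rcases le_total n m with h | h
  · obtain ⟨k, rfl⟩ := Nat.exists_eq_add_of_le h
    have h3 : ((n + k + 1).choose (n + 1) : ℂ) ≠ 0 := by
      exact_mod_cast (Nat.choose_pos (by omega)).ne'
    rw [channel_add, trace_smul, trace_cloning, timeReversal_trace, smul_eq_mul]
    push_cast
    field_simp
  · obtain ⟨k, rfl⟩ := Nat.exists_eq_add_of_le h
    have h3 : ((m + k).choose m : ℂ) ≠ 0 := by
      exact_mod_cast (Nat.choose_pos (by omega)).ne'
    rw [channel_add_left, trace_smul, timeReversal_trace, trace_reduction, smul_eq_mul]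
    push_cast
    field_simp

theorem channel_posSemidef (n m : ℕ) {ρ : SpinOp n} (hρ : ρ.PosSemidef) :
    (channel n m ρ).PosSemidef := by
  rcases le_total n m with h | h
  · obtain ⟨k, rfl⟩ := Nat.exists_eq_add_of_le h
    rw [channel_add, cloning_eq_krausMap]
    exact (krausMap_posSemidef _ (timeReversal_posSemidef hρ)).smul
      (by rw [Complex.zero_le_real]; positivity)
  · obtain ⟨k, rfl⟩ := Nat.exists_eq_add_of_le h
    rw [channel_add_left]
    exact (timeReversal_posSemidef (krausMap_posSemidef _ hρ)).smul
      (by rw [Complex.zero_le_real]; positivity)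

theorem isDensityMatrix_channel (n m : ℕ) {ρ : SpinOp n} (hρ : IsDensityMatrix ρ) :
    IsDensityMatrix (channel n m ρ) :=
  ⟨channel_posSemidef n m hρ.1, by rw [trace_channel, hρ.2]⟩

/-- Multiplication by `x^n` keeps the power of `y`, so only `q = s` contributes. The entries with `s
> k` vanish, as does the binomial. -/
theorem cloning_single (n k : ℕ) : cloning n k (n + k) (Matrix.single 0 0 1) =
    diagonal fun s : Fin (n + k + 1) => (((n + k - (s : ℕ)).choose n : ℝ) : ℂ) := by
  ext s s'
  have h0 : ∀ q : Fin (k + 1), ∑ i : Fin (n + 1), ∑ i' : Fin (n + 1),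
      (fusionCoeff n k s i q : ℂ) * (fusionCoeff n k s' i' q : ℂ) *
        (Matrix.single 0 0 1 : SpinOp n) i i' =
      (fusionCoeff n k s 0 q : ℂ) * (fusionCoeff n k s' 0 q : ℂ) := by
    intro q
    rw [Fintype.sum_eq_single 0, Fintype.sum_eq_single 0]
    · simp
    · intro i' hi'
      simp [hi'.symm]
    · intro i hi
      simp [hi.symm]
  simp only [cloning, of_apply, h0, diagonal_apply]
  by_cases h : s = s'
  · subst h
    rw [if_pos rfl]
    by_cases hk : (s : ℕ) ≤ k
    · rw [Fintype.sum_eq_single ⟨s, by omega⟩]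
      · have := fusionCoeff_sq (Nat.zero_le n) hk
        rw [zero_add, Nat.choose_zero_right, one_mul, Nat.sub_zero] at this
        simp only
        rw [← Complex.ofReal_mul, ← sq, this]
      · intro q hq
        have : (s : ℕ) ≠ 0 + q := fun h => hq (Fin.ext (by simp; omega))
        rw [fusionCoeff_of_ne n k this]
        simp
    · rw [Nat.choose_eq_zero_of_lt (by omega), sum_eq_zero]
      · simp
      · intro q _
        rw [fusionCoeff_of_ne n k (show (s : ℕ) ≠ 0 + q by have := q.is_lt; omega)]
        simp
  · rw [if_neg h, sum_eq_zero]
    intro q _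
    have h' : (s : ℕ) ≠ s' := fun h' => h (Fin.ext h')
    by_cases h1 : (s : ℕ) = 0 + q
    · rw [fusionCoeff_of_ne n k (show (s' : ℕ) ≠ 0 + q by omega)]
      simp
    · rw [fusionCoeff_of_ne n k h1]
      simp

/-- `y^(m+k)` factors into monomials of degrees `m` and `k` only as `y^m y^k`, so a coherent state
stays pure. -/
theorem reduction_single (m k : ℕ) :
    reduction m k (Matrix.single (Fin.last (m + k)) (Fin.last (m + k)) 1) =
      (((m + k).choose m : ℝ) : ℂ) • Matrix.single (Fin.last m) (Fin.last m) 1 := by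
  ext j j'
  have h0 : ∀ q : Fin (k + 1), ∑ i : Fin (m + k + 1), ∑ i' : Fin (m + k + 1),
      (fusionCoeff m k i j q : ℂ) * (fusionCoeff m k i' j' q : ℂ) *
        (Matrix.single (Fin.last (m + k)) (Fin.last (m + k)) 1 : SpinOp (m + k)) i i' =
      (fusionCoeff m k (m + k) j q : ℂ) * (fusionCoeff m k (m + k) j' q : ℂ) := by
    intro q
    rw [Fintype.sum_eq_single (Fin.last (m + k)), Fintype.sum_eq_single (Fin.last (m + k))]
    · simp
    · intro i' hi'
      simp [hi'.symm]
    · intro i hi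
      simp [hi.symm]
  simp only [reduction, krausMap, of_apply, h0]
  simp only [Matrix.smul_apply, single_apply]
  have hne : ∀ j : Fin (m + 1), j ≠ Fin.last m → ∀ q : Fin (k + 1),
      fusionCoeff m k (m + k) j q = 0 := by
    intro j hj q
    refine fusionCoeff_of_ne m k ?_
    have h1 : (j : ℕ) ≠ m := fun h => hj (Fin.ext h)
    have := j.is_lt
    have := q.is_lt
    omega
  by_cases h : j = Fin.last m
  · by_cases h' : j' = Fin.last m
    · subst h
      subst h'
      rw [Fintype.sum_eq_single (Fin.last k)]
      · have := fusionCoeff_sq (le_refl m) (le_refl k)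
        rw [Nat.sub_self, Nat.sub_self, Nat.choose_zero_right, mul_one] at this
        rw [← Complex.ofReal_mul, ← sq, Fin.val_last, Fin.val_last, this]
        simp
      · intro q hq
        have h1 : (q : ℕ) ≠ k := fun h => hq (Fin.ext h)
        rw [fusionCoeff_of_ne m k (show m + k ≠ (Fin.last m : ℕ) + q by simp; omega)]
        simp
    · rw [sum_eq_zero fun q _ => by rw [hne j' h']; simp]
      simp [Ne.symm h']
  · rw [sum_eq_zero fun q _ => by rw [hne j h]; simp]
    simp [Ne.symm h]

theorem kyFanLE_of_trace_eq_one {N : ℕ} {B : SpinOp N} (hB : B.PosSemidef)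
    (htr : B.trace = 1) (r : ℕ) :
    KyFanLE B r (∑ i : Fin (N + 1) with i.val < r, if i = 0 then (1 : ℝ) else 0) := by
  intro X h1 h2 h3
  rw [sum_filter]
  -- For `r = 0` a projection of nonpositive trace is zero; for `r ≥ 1` the bound is the full trace.
  by_cases hr : r = 0
  · subst hr
    have h4 := trace_re_nonneg_of_isProj h1 h2
    have h5 : (Xᴴ * X).trace = 0 := by
      have h6 := (Complex.nonneg_iff.mp (posSemidef_conjTranspose_mul_self X).trace_nonneg).2
      rw [h1.eq, h2] at h6 ⊢
      exact Complex.ext (by simp at h3 ⊢; linarith) h6.symm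
    rw [trace_conjTranspose_mul_self_eq_zero_iff] at h5
    simp [h5]
  · rw [Fintype.sum_eq_single 0]
    · rw [if_pos (by simpa using Nat.pos_of_ne_zero hr), if_pos rfl]
      have h4 : (1 - X) * (1 - X) = 1 - X := by simp [Matrix.mul_sub, Matrix.sub_mul, h2]
      have h5 := (Complex.nonneg_iff.mp
        (hB.mul_mul_conjTranspose_same (1 - X)).trace_nonneg).1
      rw [(isHermitian_one.sub h1).eq, trace_mul_comm, ← Matrix.mul_assoc, h4, Matrix.sub_mul,
        trace_sub, Matrix.one_mul, htr] at h5
      simp at h5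
      linarith
    · intro i hi
      simp [hi]

/-- `channel` applied to the lowest weight state is diagonal and majorizes all outputs. -/
theorem exists_diagonal_majorizing (n m : ℕ) : ∃ d : Fin (m + 1) → ℝ, Antitone d ∧
    channel n m (Matrix.single (Fin.last n) (Fin.last n) 1) = (diagonal fun i => (d i : ℂ)) ∧
    ∀ ρ : SpinOp n, IsDensityMatrix ρ → ∀ r : ℕ,
      KyFanLE (channel n m ρ) r (∑ i : Fin (m + 1) with i.val < r, d i) := by
  rcases le_total n m with h | h
  · obtain ⟨k, rfl⟩ := Nat.exists_eq_add_of_le h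
    refine ⟨fun s => ((n + k + 1).choose (n + 1) : ℝ)⁻¹ * ((n + k - (s : ℕ)).choose n : ℝ),
      ?_, ?_, ?_⟩
    · intro s s' hs
      have hs' : (s : ℕ) ≤ s' := hs
      have : (n + k - (s' : ℕ)).choose n ≤ (n + k - (s : ℕ)).choose n :=
        Nat.choose_le_choose n (by omega)
      have h2 : ((n + k - (s' : ℕ)).choose n : ℝ) ≤ (n + k - (s : ℕ)).choose n := by
        exact_mod_cast this
      exact mul_le_mul_of_nonneg_left h2 (by positivity)
    · rw [channel_add, timeReversal_single, cloning_single, ← diagonal_smul]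
      congr 1
      ext s
      simp
    · intro ρ hρ r
      have h1 := kyFanLE_cloning (n + k) n k rfl _ (timeReversal_posSemidef hρ.1) r
      rw [timeReversal_trace, hρ.2, Complex.one_re, one_mul] at h1
      rw [channel_add, ← mul_sum]
      exact h1.smul (by positivity)
  · obtain ⟨k, rfl⟩ := Nat.exists_eq_add_of_le h
    refine ⟨fun s => if s = 0 then 1 else 0, ?_, ?_, ?_⟩
    · intro s s' hs
      by_cases h0 : s = 0
      · simp only [h0, if_true]
        split_ifs <;> norm_num
      · have : s' ≠ 0 := by
          rintro rfl
          exact h0 (Fin.le_zero_iff.mp hs)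
        simp [h0, this]
    · have h3 : ((m + k).choose m : ℂ) ≠ 0 := by
        exact_mod_cast (Nat.choose_pos (by omega)).ne'
      have h4 : ∀ c : ℂ, ∀ ρ : SpinOp m, timeReversal m (c • ρ) = c • timeReversal m ρ := by
        intro c ρ
        ext i i'
        simp only [timeReversal, of_apply, Matrix.smul_apply, smul_eq_mul]
        ring
      rw [channel_add_left, reduction_single, h4, timeReversal_single, smul_smul]
      push_cast
      rw [inv_mul_cancel₀ h3, one_smul]
      ext i j
      simp only [single_apply, diagonal_apply]
      by_cases hi : i = 0
      · subst hi
        by_cases hj : 0 = j <;> simp [hj]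
      · simp [hi, Ne.symm hi]
    · intro ρ hρ r
      have h1 := isDensityMatrix_channel (m + k) m hρ
      exact kyFanLE_of_trace_eq_one h1.1 h1.2 r

end Channel

/-! ### Unitaries implementing rotations -/

section Rotation

open scoped Matrix.Norms.L2Operator in
/-- Conjugation by `exp (-iθZ)` rotates the `X, Y` plane of an `su(2)` triple. -/
theorem exists_unitary_rotating {ι : Type*} [Fintype ι] [DecidableEq ι] {X Y Z : Matrix ι ι ℂ}
    (hX : X.IsHermitian) (hY : Y.IsHermitian) (hZ : Z.IsHermitian)
    (h1 : Y * Z - Z * Y = Complex.I • X) (h2 : Z * X - X * Z = Complex.I • Y) (θ : ℝ) :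
    ∃ U : Matrix ι ι ℂ, Uᴴ * U = 1 ∧ U * Uᴴ = 1 ∧
      U * X * Uᴴ = (Real.cos θ : ℂ) • X + (Real.sin θ : ℂ) • Y ∧
      U * Y * Uᴴ = (Real.cos θ : ℂ) • Y - (Real.sin θ : ℂ) • X ∧ U * Z * Uᴴ = Z := by
  let +nondep : NormedAlgebra ℚ (Matrix ι ι ℂ) := .restrictScalars ℚ ℂ (Matrix ι ι ℂ)
  set c : ℂ := -(Complex.I * θ) with hc
  set U : Matrix ι ι ℂ := NormedSpace.exp (c • Z) with hU
  have hmem : U ∈ unitary (Matrix ι ι ℂ) := by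
    refine NormedSpace.exp_mem_unitary_of_mem_skewAdjoint ?_
    rw [skewAdjoint.mem_iff, star_smul, star_eq_conjTranspose, hZ.eq, ← neg_smul]
    congr 1
    simp [hc]
  have hUU : Uᴴ * U = 1 := hmem.1
  have hUU' : U * Uᴴ = 1 := hmem.2
  set E : Matrix ι ι ℂ := X + Complex.I • Y with hE
  -- `E = X + iY` is a ladder operator for `Z`. Exponentiating this relation gives `U E U* = e^(-iθ)
  -- E`, and `X`, `Y` are recovered from `E` and its adjoint.
  have hEZ : E * (Z + 1) = Z * E := by
    simp only [hE, Matrix.add_mul, Matrix.mul_add, Matrix.smul_mul, Matrix.mul_smul, Matrix.mul_one]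
    have h1' : Y * Z = Z * Y + Complex.I • X := by rw [← h1]; abel
    have h2' : X * Z = Z * X - Complex.I • Y := by rw [← h2]; abel
    rw [h1', h2', smul_add, smul_smul, Complex.I_mul_I]
    module
  have hsc : SemiconjBy E (c • Z + c • 1) (c • Z) := by
    rw [SemiconjBy, ← smul_add, Matrix.mul_smul, hEZ, Matrix.smul_mul]
  have hexp1 : NormedSpace.exp (c • (1 : Matrix ι ι ℂ)) = Complex.exp c • 1 := by
    have := NormedSpace.algebraMap_exp_comm (𝔸 := Matrix ι ι ℂ) c
    rw [Algebra.algebraMap_eq_smul_one, Algebra.algebraMap_eq_smul_one] at this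
    rw [← this, Complex.exp_eq_exp_ℂ]
  have hUE : U * E = Complex.exp c • (E * U) := by
    have h3 := hsc.exp_right
    rw [SemiconjBy, NormedSpace.exp_add_of_commute ((Commute.one_right (c • Z)).smul_right c),
      hexp1, Matrix.mul_smul, Matrix.mul_one, Matrix.mul_smul] at h3
    exact h3.symm
  have hconj : U * E * Uᴴ = Complex.exp c • E := by
    rw [hUE, Matrix.smul_mul, Matrix.mul_assoc, hUU', Matrix.mul_one]
  have hconj' : U * Eᴴ * Uᴴ = star (Complex.exp c) • Eᴴ := by
    have := congrArg conjTranspose hconj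
    rwa [conjTranspose_mul, conjTranspose_mul, conjTranspose_conjTranspose, conjTranspose_smul,
      ← Matrix.mul_assoc] at this
  have hEh : Eᴴ = X - Complex.I • Y := by
    rw [hE, conjTranspose_add, conjTranspose_smul, hX.eq, hY.eq]
    simp [sub_eq_add_neg]
  have hexp : Complex.exp c = Real.cos θ - Complex.I * Real.sin θ := by
    rw [hc, ← mul_neg, mul_comm, Complex.exp_mul_I, Complex.cos_neg, Complex.sin_neg]
    push_cast
    ring
  have hexp' : star (Complex.exp c) = Real.cos θ + Complex.I * Real.sin θ := by
    rw [hexp, star_sub, star_mul', Complex.star_def, Complex.conj_I, Complex.conj_ofReal,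
      Complex.conj_ofReal]
    ring
  generalize Real.cos θ = a at hexp hexp' ⊢
  generalize Real.sin θ = b at hexp hexp' ⊢
  have hXE : X = (1 / 2 : ℂ) • (E + Eᴴ) := by
    rw [hEh, hE]
    module
  have hYE : Y = (-Complex.I / 2 : ℂ) • (E - Eᴴ) := by
    have : (-Complex.I / 2 : ℂ) * (2 * Complex.I) = 1 := by
      linear_combination -Complex.I_mul_I
    rw [hEh, hE, show X + Complex.I • Y - (X - Complex.I • Y) = (2 * Complex.I) • Y by module,
      smul_smul, this, one_smul]
  refine ⟨U, hUU, hUU', ?_, ?_, ?_⟩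
  · nth_rw 1 [hXE]
    rw [Matrix.mul_smul, Matrix.smul_mul, Matrix.mul_add, Matrix.add_mul, hconj, hconj', hexp',
      hexp, hEh, hE]
    match_scalars
    · ring
    · linear_combination (-b : ℂ) * Complex.I_mul_I
  · nth_rw 1 [hYE]
    rw [Matrix.mul_smul, Matrix.smul_mul, Matrix.mul_sub, Matrix.sub_mul, hconj, hconj', hexp',
      hexp, hEh, hE]
    match_scalars
    · linear_combination (b : ℂ) * Complex.I_mul_I
    · linear_combination (-a : ℂ) * Complex.I_mul_I
  · have : U * Z = Z * U :=
      (((Commute.refl Z).smul_right c).exp_right).eq.symm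
    rw [this, Matrix.mul_assoc, hUU', Matrix.mul_one]

theorem spinX_isHermitian (n : ℕ) : (spinX n).IsHermitian := by
  rw [IsHermitian, spinX, conjTranspose_smul, conjTranspose_add, conjTranspose_conjTranspose,
    add_comm (spinRaise n)ᴴ]
  congr 1
  simp

theorem spinY_isHermitian (n : ℕ) : (spinY n).IsHermitian := by
  rw [IsHermitian, spinY, conjTranspose_smul, conjTranspose_sub, conjTranspose_conjTranspose,
    ← neg_sub, smul_neg, ← neg_smul]
  congr 1
  simp

theorem spinZ_isHermitian (n : ℕ) : (spinZ n).IsHermitian := by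
  refine isHermitian_diagonal_iff.mpr fun i => ?_
  simp [IsSelfAdjoint]

theorem spinX_spinY_comm (n : ℕ) :
    spinX n * spinY n - spinY n * spinX n = Complex.I • spinZ n := by
  have h : spinRaise n * (spinRaise n)ᴴ - (spinRaise n)ᴴ * spinRaise n = (2 : ℂ) • spinZ n := by
    rw [spinRaise_mul_conjTranspose, conjTranspose_spinRaise_mul, diagonal_sub, spinZ,
      ← diagonal_smul]
    congr 1
    ext i
    simp only [Pi.smul_apply, smul_eq_mul]
    ring
  have h2 : (1 / (2 * Complex.I)) = -(Complex.I / 2) := by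
    field_simp
    rw [Complex.I_sq, neg_neg]
  have h3 : spinZ n = (1 / 2 : ℂ) • (spinRaise n * (spinRaise n)ᴴ -
      (spinRaise n)ᴴ * spinRaise n) := by
    rw [h]
    module
  rw [h3]
  simp only [spinX, spinY, Matrix.smul_mul, Matrix.mul_smul, smul_smul, h2, Matrix.mul_add,
    Matrix.add_mul, Matrix.mul_sub, Matrix.sub_mul]
  module

theorem spinZ_mul_spinRaise (n : ℕ) :
    spinZ n * spinRaise n - spinRaise n * spinZ n = spinRaise n := by
  ext i j
  simp only [spinZ, spinRaise, Matrix.sub_apply, diagonal_mul, mul_diagonal, of_apply]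
  split_ifs with h
  · rw [← h]
    push_cast
    ring
  · simp

theorem spinZ_mul_spinRaise_conjTranspose (n : ℕ) :
    spinZ n * (spinRaise n)ᴴ - (spinRaise n)ᴴ * spinZ n = -(spinRaise n)ᴴ := by
  have := congrArg conjTranspose (spinZ_mul_spinRaise n)
  rw [conjTranspose_sub, conjTranspose_mul, conjTranspose_mul, (spinZ_isHermitian n).eq] at this
  nth_rw 3 [← this]
  abel

theorem spinY_spinZ_comm (n : ℕ) :
    spinY n * spinZ n - spinZ n * spinY n = Complex.I • spinX n := by
  have h2 : (1 / (2 * Complex.I)) = -(Complex.I / 2) := by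
    field_simp
    rw [Complex.I_sq, neg_neg]
  have h3 : spinZ n * spinRaise n = spinRaise n * spinZ n + spinRaise n :=
    sub_eq_iff_eq_add'.mp (spinZ_mul_spinRaise n)
  have h4 : spinZ n * (spinRaise n)ᴴ = (spinRaise n)ᴴ * spinZ n + -(spinRaise n)ᴴ :=
    sub_eq_iff_eq_add'.mp (spinZ_mul_spinRaise_conjTranspose n)
  simp only [spinX, spinY, Matrix.smul_mul, Matrix.mul_smul, smul_smul, h2, Matrix.mul_sub,
    Matrix.sub_mul, h3, h4]
  module

theorem spinZ_spinX_comm (n : ℕ) :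
    spinZ n * spinX n - spinX n * spinZ n = Complex.I • spinY n := by
  have h2 : Complex.I * (1 / (2 * Complex.I)) = 1 / 2 := by
    field_simp
  have h3 : spinZ n * spinRaise n = spinRaise n * spinZ n + spinRaise n :=
    sub_eq_iff_eq_add'.mp (spinZ_mul_spinRaise n)
  have h4 : spinZ n * (spinRaise n)ᴴ = (spinRaise n)ᴴ * spinZ n + -(spinRaise n)ᴴ :=
    sub_eq_iff_eq_add'.mp (spinZ_mul_spinRaise_conjTranspose n)
  simp only [spinX, spinY, Matrix.smul_mul, Matrix.mul_smul, smul_smul, h2, Matrix.mul_add,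
    Matrix.add_mul, h3, h4]
  module

/-- The unitary `U` on spin `n / 2` implements the rotation `R`. -/
structure ImplementsRotation (n : ℕ) (R : Matrix (Fin 3) (Fin 3) ℝ) (U : SpinOp n) : Prop where
  conjTranspose_mul : Uᴴ * U = 1
  mul_conjTranspose : U * Uᴴ = 1
  conj_spinVec : ∀ a, U * spinVec n a * Uᴴ = ∑ b, (R b a : ℂ) • spinVec n b

theorem ImplementsRotation.mul {n : ℕ} {R R' : Matrix (Fin 3) (Fin 3) ℝ} {U U' : SpinOp n}
    (h : ImplementsRotation n R U) (h' : ImplementsRotation n R' U') :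
    ImplementsRotation n (R * R') (U * U') := by
  refine ⟨?_, ?_, ?_⟩
  · rw [Matrix.conjTranspose_mul, Matrix.mul_assoc, ← Matrix.mul_assoc Uᴴ, h.conjTranspose_mul,
      Matrix.one_mul, h'.conjTranspose_mul]
  · rw [Matrix.conjTranspose_mul, Matrix.mul_assoc, ← Matrix.mul_assoc U', h'.mul_conjTranspose,
      Matrix.one_mul, h.mul_conjTranspose]
  · intro a
    calc _ = U * (U' * spinVec n a * U'ᴴ) * Uᴴ := by
          rw [Matrix.conjTranspose_mul]
          simp only [Matrix.mul_assoc]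
      _ = ∑ c, (R' c a : ℂ) • (U * spinVec n c * Uᴴ) := by
          rw [h'.conj_spinVec, Matrix.mul_sum, Matrix.sum_mul]
          simp only [Matrix.mul_smul, Matrix.smul_mul]
      _ = _ := by
          simp only [h.conj_spinVec, smul_sum, smul_smul, mul_apply, Complex.ofReal_sum, sum_smul,
            Complex.ofReal_mul]
          rw [sum_comm]
          simp only [mul_comm]

/-- Rotation about the third axis. -/
def rotZ (θ : ℝ) : Matrix (Fin 3) (Fin 3) ℝ :=
  !![Real.cos θ, -Real.sin θ, 0; Real.sin θ, Real.cos θ, 0; 0, 0, 1]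

/-- Rotation about the second axis. -/
def rotY (θ : ℝ) : Matrix (Fin 3) (Fin 3) ℝ :=
  !![Real.cos θ, 0, Real.sin θ; 0, 1, 0; -Real.sin θ, 0, Real.cos θ]

theorem rotZ_mul_transpose (θ : ℝ) : rotZ θ * (rotZ θ)ᵀ = 1 := by
  have := Real.sin_sq_add_cos_sq θ
  ext i j
  fin_cases i <;> fin_cases j <;>
    simp [rotZ, mul_apply, Fin.sum_univ_three] <;> nlinarith

theorem rotY_mul_transpose (θ : ℝ) : rotY θ * (rotY θ)ᵀ = 1 := by
  have := Real.sin_sq_add_cos_sq θ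
  ext i j
  fin_cases i <;> fin_cases j <;>
    simp [rotY, mul_apply, Fin.sum_univ_three] <;> nlinarith

theorem exists_implementsRotation_rotZ (n : ℕ) (θ : ℝ) :
    ∃ U : SpinOp n, ImplementsRotation n (rotZ θ) U := by
  obtain ⟨U, h1, h2, h3, h4, h5⟩ := exists_unitary_rotating (spinX_isHermitian n)
    (spinY_isHermitian n) (spinZ_isHermitian n) (spinY_spinZ_comm n) (spinZ_spinX_comm n) θ
  refine ⟨U, h1, h2, fun a => ?_⟩
  fin_cases a
  · simpa [-Complex.ofReal_cos, -Complex.ofReal_sin, spinVec, rotZ, Fin.sum_univ_three] using h3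
  · simpa [-Complex.ofReal_cos, -Complex.ofReal_sin, spinVec, rotZ, Fin.sum_univ_three, sub_eq_add_neg, add_comm] using h4
  · simpa [-Complex.ofReal_cos, -Complex.ofReal_sin, spinVec, rotZ, Fin.sum_univ_three] using h5

theorem exists_implementsRotation_rotY (n : ℕ) (θ : ℝ) :
    ∃ U : SpinOp n, ImplementsRotation n (rotY θ) U := by
  obtain ⟨U, h1, h2, h3, h4, h5⟩ := exists_unitary_rotating (spinZ_isHermitian n)
    (spinX_isHermitian n) (spinY_isHermitian n) (spinX_spinY_comm n) (spinY_spinZ_comm n) θ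
  refine ⟨U, h1, h2, fun a => ?_⟩
  fin_cases a
  · simpa [-Complex.ofReal_cos, -Complex.ofReal_sin, spinVec, rotY, Fin.sum_univ_three, sub_eq_add_neg] using h4
  · simpa [-Complex.ofReal_cos, -Complex.ofReal_sin, spinVec, rotY, Fin.sum_univ_three] using h5
  · simpa [-Complex.ofReal_cos, -Complex.ofReal_sin, spinVec, rotY, Fin.sum_univ_three, add_comm] using h3

/-- Every point of the sphere is the image of the north pole under a product of two axial
rotations. -/
theorem exists_rotZ_mul_rotY (ω : Sphere2) : ∃ β α : ℝ, ∀ a, (rotZ β * rotY α) a 2 = ω.1 a := by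
  have hω : ω.1 0 ^ 2 + ω.1 1 ^ 2 + ω.1 2 ^ 2 = 1 := by
    have h := ω.2
    rw [mem_sphere_zero_iff_norm, EuclideanSpace.norm_eq, Real.sqrt_eq_one,
      Fin.sum_univ_three] at h
    simpa using h
  -- Spherical coordinates: azimuth `arg z`, polar angle `arccos ω₂`. The poles need no separate
  -- case, since `‖z‖ cos (arg z) = re z` also holds at `z = 0`.
  set z : ℂ := ⟨ω.1 0, ω.1 1⟩ with hz
  have hs : Real.sin (Real.arccos (ω.1 2)) = ‖z‖ := by
    rw [Real.sin_arccos, Complex.norm_eq_sqrt_sq_add_sq]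
    congr 1
    simp only [hz]
    linarith
  have hc : Real.cos (Real.arccos (ω.1 2)) = ω.1 2 :=
    Real.cos_arccos (by nlinarith [sq_nonneg (ω.1 0), sq_nonneg (ω.1 1)])
      (by nlinarith [sq_nonneg (ω.1 0), sq_nonneg (ω.1 1)])
  have h0 : ‖z‖ * Real.cos z.arg = ω.1 0 := Complex.norm_mul_cos_arg z
  have h1 : ‖z‖ * Real.sin z.arg = ω.1 1 := Complex.norm_mul_sin_arg z
  refine ⟨z.arg, Real.arccos (ω.1 2), fun a => ?_⟩
  fin_cases a
  · simp [rotZ, rotY, mul_apply, Fin.sum_univ_three, hs]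
    linarith
  · simp [rotZ, rotY, mul_apply, Fin.sum_univ_three, hs]
    linarith
  · simp [rotZ, rotY, mul_apply, Fin.sum_univ_three, hc]

theorem exists_rotation (ω : Sphere2) : ∃ R : Matrix (Fin 3) (Fin 3) ℝ, R * Rᵀ = 1 ∧
    (∀ a, R a 2 = ω.1 a) ∧ ∀ n : ℕ, ∃ U : SpinOp n, ImplementsRotation n R U := by
  obtain ⟨β, α, h⟩ := exists_rotZ_mul_rotY ω
  refine ⟨rotZ β * rotY α, ?_, h, fun n => ?_⟩
  · rw [transpose_mul, Matrix.mul_assoc, ← Matrix.mul_assoc (rotY α), rotY_mul_transpose,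
      Matrix.one_mul, rotZ_mul_transpose]
  · obtain ⟨U, hU⟩ := exists_implementsRotation_rotZ n β
    obtain ⟨U', hU'⟩ := exists_implementsRotation_rotY n α
    exact ⟨U * U', hU.mul hU'⟩

end Rotation

/-! ### Rotation covariance of the channel and the conclusion -/

section Covariance

theorem ImplementsRotation.conj_totalSpinSq {n m : ℕ} {R : Matrix (Fin 3) (Fin 3) ℝ}
    {U : SpinOp n} {V : SpinOp m} (hR : R * Rᵀ = 1) (hU : ImplementsRotation n R U)
    (hV : ImplementsRotation m R V) :
    (U ⊗ₖ V) * totalSpinSq n m * (U ⊗ₖ V)ᴴ = totalSpinSq n m := by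
  have hone : (U ⊗ₖ V) * (U ⊗ₖ V)ᴴ = 1 := by
    rw [conjTranspose_kronecker, ← mul_kronecker_mul, hU.mul_conjTranspose, hV.mul_conjTranspose,
      one_kronecker_one]
  have hterm : ∀ a, (U ⊗ₖ V) * (spinVec n a ⊗ₖ spinVec m a) * (U ⊗ₖ V)ᴴ =
      ∑ b, ∑ c, ((R b a * R c a : ℝ) : ℂ) • (spinVec n b ⊗ₖ spinVec m c) := by
    intro a
    rw [conjTranspose_kronecker, ← mul_kronecker_mul, ← mul_kronecker_mul, hU.conj_spinVec,
      hV.conj_spinVec]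
    simp only [Fin.sum_univ_three, add_kronecker, kronecker_add, smul_kronecker, kronecker_smul,
      Complex.ofReal_mul]
    module
  have hRR : ∀ b c, ∑ a, R b a * R c a = if b = c then 1 else 0 := by
    intro b c
    have := congrFun (congrFun hR b) c
    rwa [mul_apply, Matrix.one_apply] at this
  have hsum : (U ⊗ₖ V) * (∑ a, spinVec n a ⊗ₖ spinVec m a) * (U ⊗ₖ V)ᴴ =
      ∑ a, spinVec n a ⊗ₖ spinVec m a := by
    rw [Matrix.mul_sum, Matrix.sum_mul, sum_congr rfl fun a _ => hterm a, sum_comm]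
    refine sum_congr rfl fun b _ => ?_
    rw [sum_comm, Fintype.sum_eq_single b]
    · rw [← sum_smul, ← Complex.ofReal_sum, hRR, if_pos rfl, Complex.ofReal_one, one_smul]
    · intro c hc
      rw [← sum_smul, ← Complex.ofReal_sum, hRR, if_neg hc.symm, Complex.ofReal_zero, zero_smul]
  rw [totalSpinSq_eq, Matrix.mul_add, Matrix.add_mul, Matrix.mul_smul, Matrix.smul_mul,
    Matrix.mul_one, hone, Matrix.mul_smul, Matrix.smul_mul, hsum]

variable {ι κ : Type*} [Fintype ι] [Fintype κ]

theorem partialTraceLeft_kronecker_one_mul_comm [DecidableEq κ] (U : Matrix ι ι ℂ)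
    (A : Matrix (ι × κ) (ι × κ) ℂ) :
    partialTraceLeft ((U ⊗ₖ (1 : Matrix κ κ ℂ)) * A) =
      partialTraceLeft (A * (U ⊗ₖ (1 : Matrix κ κ ℂ))) := by
  ext a b
  simp only [partialTraceLeft, of_apply, mul_apply, Fintype.sum_prod_type, kroneckerMap_apply,
    Matrix.one_apply, mul_ite, mul_one, mul_zero, ite_mul, zero_mul, sum_ite_eq, sum_ite_eq',
    mem_univ, if_true]
  rw [sum_comm]
  simp only [mul_comm]

theorem partialTraceLeft_one_kronecker_mul [DecidableEq ι] (V : Matrix κ κ ℂ)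
    (A : Matrix (ι × κ) (ι × κ) ℂ) :
    partialTraceLeft (((1 : Matrix ι ι ℂ) ⊗ₖ V) * A) = V * partialTraceLeft A := by
  ext a b
  simp only [partialTraceLeft, of_apply, mul_apply, Fintype.sum_prod_type, kroneckerMap_apply,
    Matrix.one_apply, ite_mul, zero_mul, one_mul, mul_sum]
  rw [sum_comm]
  refine (sum_congr rfl fun i _ => ?_).trans sum_comm
  rw [Fintype.sum_eq_single i]
  · simp
  · intro j hj
    simp [hj]

theorem partialTraceLeft_mul_one_kronecker [DecidableEq ι] (V : Matrix κ κ ℂ)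
    (A : Matrix (ι × κ) (ι × κ) ℂ) :
    partialTraceLeft (A * ((1 : Matrix ι ι ℂ) ⊗ₖ V)) = partialTraceLeft A * V := by
  ext a b
  simp only [partialTraceLeft, of_apply, mul_apply, Fintype.sum_prod_type, kroneckerMap_apply,
    Matrix.one_apply, ite_mul, zero_mul, one_mul, sum_mul]
  refine (sum_congr rfl fun i _ => ?_).trans sum_comm
  rw [Fintype.sum_eq_single i]
  · simp
  · intro j hj
    simp [hj]

theorem partialTraceLeft_conj [DecidableEq ι] [DecidableEq κ] {U : Matrix ι ι ℂ}
    (hU : Uᴴ * U = 1) (V : Matrix κ κ ℂ) (A : Matrix (ι × κ) (ι × κ) ℂ) :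
    partialTraceLeft ((U ⊗ₖ V) * A * (U ⊗ₖ V)ᴴ) = V * partialTraceLeft A * Vᴴ := by
  have h1 : (U ⊗ₖ V) = (U ⊗ₖ 1) * (1 ⊗ₖ V) := by
    rw [← mul_kronecker_mul, Matrix.mul_one, Matrix.one_mul]
  have h2 : (U ⊗ₖ V)ᴴ = (1 ⊗ₖ Vᴴ) * (Uᴴ ⊗ₖ 1) := by
    rw [conjTranspose_kronecker, ← mul_kronecker_mul, Matrix.mul_one, Matrix.one_mul]
  have h3 : (Uᴴ ⊗ₖ (1 : Matrix κ κ ℂ)) * (U ⊗ₖ 1) = 1 := by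
    rw [← mul_kronecker_mul, hU, Matrix.one_mul, one_kronecker_one]
  rw [h2, h1, Matrix.mul_assoc (U ⊗ₖ 1), Matrix.mul_assoc (U ⊗ₖ 1),
    partialTraceLeft_kronecker_one_mul_comm]
  simp only [Matrix.mul_assoc, h3, Matrix.mul_one]
  rw [partialTraceLeft_one_kronecker_mul, partialTraceLeft_mul_one_kronecker]

/-- `U ⊗ V` commutes with the total Casimir, hence with `P_-`. Under the partial trace `U` cancels
by cyclicity in the first factor, while `V` comes out. -/
theorem channel_conj {n m : ℕ} {R : Matrix (Fin 3) (Fin 3) ℝ} {U : SpinOp n} {V : SpinOp m}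
    (hR : R * Rᵀ = 1) (hU : ImplementsRotation n R U) (hV : ImplementsRotation m R V)
    (ρ : SpinOp n) : channel n m (U * ρ * Uᴴ) = V * channel n m ρ * Vᴴ := by
  have hW : (U ⊗ₖ V)ᴴ * (U ⊗ₖ V) = 1 := by
    rw [conjTranspose_kronecker, ← mul_kronecker_mul, hU.conjTranspose_mul, hV.conjTranspose_mul,
      one_kronecker_one]
  have hW' : (U ⊗ₖ V) * (U ⊗ₖ V)ᴴ = 1 := by
    rw [conjTranspose_kronecker, ← mul_kronecker_mul, hU.mul_conjTranspose, hV.mul_conjTranspose,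
      one_kronecker_one]
  have hP : (U ⊗ₖ V) * minSpinProj n m * (U ⊗ₖ V)ᴴ = minSpinProj n m := by
    have h := (isEigenProj_eigenProj (totalSpinSq n m)
      ((minSpin n m * (minSpin n m + 1) : ℝ) : ℂ)).conj hW hW'
    rw [hU.conj_totalSpinSq hR hV] at h
    exact h.unique (isEigenProj_eigenProj _ _)
  have hmul : minSpinProj n m * ((U * ρ * Uᴴ) ⊗ₖ (1 : SpinOp m)) =
      (U ⊗ₖ V) * (minSpinProj n m * (ρ ⊗ₖ (1 : SpinOp m))) * (U ⊗ₖ V)ᴴ := by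
    have h1 : (U * ρ * Uᴴ) ⊗ₖ (1 : SpinOp m) = (U ⊗ₖ V) * (ρ ⊗ₖ 1) * (U ⊗ₖ V)ᴴ := by
      rw [conjTranspose_kronecker, ← mul_kronecker_mul, ← mul_kronecker_mul, Matrix.mul_one,
        hV.mul_conjTranspose]
    nth_rw 1 [← hP]
    rw [h1]
    calc _ = (U ⊗ₖ V) * minSpinProj n m * ((U ⊗ₖ V)ᴴ * (U ⊗ₖ V)) * (ρ ⊗ₖ 1) * (U ⊗ₖ V)ᴴ := by
          simp only [Matrix.mul_assoc]
      _ = _ := by rw [hW, Matrix.mul_one, Matrix.mul_assoc (U ⊗ₖ V)]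
  rw [channel, hmul, partialTraceLeft_conj hU.conjTranspose_mul, channel, Matrix.mul_smul,
    Matrix.smul_mul]

theorem coherentProj_eq_conj {n : ℕ} {R : Matrix (Fin 3) (Fin 3) ℝ} {U : SpinOp n}
    (hU : ImplementsRotation n R U) {ω : Sphere2} (hω : ∀ a, R a 2 = ω.1 a) :
    coherentProj n ω = U * eigenProj (spinZ n) ((n : ℂ) / 2) * Uᴴ := by
  have h := (isEigenProj_eigenProj (spinZ n) ((n : ℂ) / 2)).conj hU.conjTranspose_mul
    hU.mul_conjTranspose
  have h2 : U * spinZ n * Uᴴ = ∑ a : Fin 3, ((ω.1 a : ℝ) : ℂ) • spinVec n a := by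
    rw [show spinZ n = spinVec n 2 from rfl, hU.conj_spinVec]
    simp only [hω]
  rw [h2] at h
  exact h.eigenProj_eq

/-- A rotation taking the north pole to `ω` turns the output at the north pole into a unitary
conjugate. -/
theorem charpoly_channel_coherentProj (n m : ℕ) (ω : Sphere2) :
    (channel n m (coherentProj n ω)).charpoly =
      (channel n m (eigenProj (spinZ n) ((n : ℂ) / 2))).charpoly := by
  obtain ⟨R, hR, hω, hex⟩ := exists_rotation ω
  obtain ⟨U, hU⟩ := hex n
  obtain ⟨V, hV⟩ := hex m
  rw [coherentProj_eq_conj hU hω, channel_conj hR hU hV, charpoly_mul_comm, ← Matrix.mul_assoc,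
    hV.conjTranspose_mul, Matrix.one_mul]

/-- The south pole of the sphere. -/
def southPole : Sphere2 :=
  ⟨!₂[0, 0, -1], by
    rw [mem_sphere_zero_iff_norm, EuclideanSpace.norm_eq, Fin.sum_univ_three]
    simp⟩

theorem coherentProj_southPole (n : ℕ) :
    coherentProj n southPole = Matrix.single (Fin.last n) (Fin.last n) 1 := by
  have h : ∑ a : Fin 3, ((southPole.1 a : ℝ) : ℂ) • spinVec n a = -spinZ n := by
    simp [southPole, Fin.sum_univ_three, spinVec]
  rw [coherentProj, h]
  refine IsEigenProj.eigenProj_eq ⟨?_, ?_, ?_, ?_⟩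
  · rw [IsHermitian, conjTranspose_single, star_one]
  · simp
  · ext i j
    rw [spinZ, Matrix.neg_mul, Matrix.neg_apply, diagonal_mul, Matrix.smul_apply, smul_eq_mul,
      ← neg_mul]
    by_cases hi : Fin.last n = i
    · subst hi
      congr 1
      simp
      ring
    · simp [hi]
  · intro v hv
    have hv' : ∀ i, i ≠ Fin.last n → v i = 0 := by
      intro i hi
      have h1 := congrFun hv i
      rw [spinZ, neg_mulVec, Pi.neg_apply, mulVec_diagonal, Pi.smul_apply, smul_eq_mul] at h1
      have h2 : (((i : ℕ) : ℂ) - n) * v i = 0 := by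
        linear_combination h1
      refine (mul_eq_zero.mp h2).resolve_left ?_
      rw [sub_eq_zero]
      exact_mod_cast fun h3 => hi (Fin.ext h3)
    ext i
    rw [single_mulVec]
    by_cases hi : i = Fin.last n
    · subst hi
      simp
    · simp [hi, hv' i hi]

theorem coherentProj_posSemidef (n : ℕ) (ω : Sphere2) : (coherentProj n ω).PosSemidef := by
  have h := isEigenProj_eigenProj (∑ a : Fin 3, ((ω.1 a : ℝ) : ℂ) • spinVec n a) ((n : ℂ) / 2)
  have h2 := posSemidef_conjTranspose_mul_self (coherentProj n ω)
  rwa [coherentProj, h.isHermitian.eq, h.mul_self] at h2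

theorem sameEigenvalues_channel_coherentProj (n m : ℕ) (ω ω' : Sphere2) :
    SameEigenvalues (channel n m (coherentProj n ω)) (channel n m (coherentProj n ω')) :=
  ⟨(channel_posSemidef n m (coherentProj_posSemidef n ω)).isHermitian,
    (channel_posSemidef n m (coherentProj_posSemidef n ω')).isHermitian,
    eigenvalues₀_eq_of_charpoly_eq _ _ (by rw [charpoly_channel_coherentProj,
      charpoly_channel_coherentProj n m ω'])⟩

theorem majorizes_channel_coherentProj (n m : ℕ) {ρ : SpinOp n} (hρ : IsDensityMatrix ρ)
    (ω : Sphere2) : Majorizes (channel n m (coherentProj n ω)) (channel n m ρ) := by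
  obtain ⟨d, hd, hdiag, hKF⟩ := exists_diagonal_majorizing n m
  -- At the south pole the output is the explicit diagonal `d`, so its spectrum is that of every
  -- coherent output.
  have hsame := sameEigenvalues_channel_coherentProj n m ω southPole
  rw [coherentProj_southPole, hdiag] at hsame
  refine majorizes_of_kyFanLE hd hsame (channel_posSemidef n m hρ.1).isHermitian (hKF ρ hρ) ?_
  have htr := congrArg trace hdiag
  rw [trace_channel, trace_diagonal, trace_single_eq_same, ← Complex.ofReal_sum] at htr
  rw [trace_channel, hρ.2, htr, Complex.ofReal_re]

end Covariance

end BlochCoherent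
end

theorem theorem2p3 (n m : ℕ) :
    (∀ ρ : BlochCoherent.SpinOp n, BlochCoherent.IsDensityMatrix ρ →
      BlochCoherent.IsDensityMatrix (BlochCoherent.channel n m ρ)) ∧
    (∀ ω ω' : BlochCoherent.Sphere2,
      BlochCoherent.SameEigenvalues
        (BlochCoherent.channel n m (BlochCoherent.coherentProj n ω))
        (BlochCoherent.channel n m (BlochCoherent.coherentProj n ω'))) ∧
    (∀ ρ : BlochCoherent.SpinOp n, BlochCoherent.IsDensityMatrix ρ →
      ∀ ω : BlochCoherent.Sphere2,
        BlochCoherent.Majorizes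
          (BlochCoherent.channel n m (BlochCoherent.coherentProj n ω))
          (BlochCoherent.channel n m ρ)) :=
  ⟨fun _ hρ => BlochCoherent.isDensityMatrix_channel n m hρ,
    BlochCoherent.sameEigenvalues_channel_coherentProj n m,
    fun _ hρ ω => BlochCoherent.majorizes_channel_coherentProj n m hρ ω⟩
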